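/- Let $M$ be a smooth 3-manifold with a contact structure $\xi$ (a plane field that is locally the kernel of a smooth 1-form $\alpha$ with $\alpha\wedge d\alpha\neq 0$). Let $Y$ be a smooth vector field on $M$, transverse to $\xi$, whose flow preserves $\xi$ (a Reeb field of $\xi$). Suppose that $Y$ is contact integrable: there is a foliation $\mathcal G$ of $M$ by curves with $T\mathcal G\subset\xi$ that is preserved by the flow of $Y$. Suppose moreover that the associated co-Legendrian foliation is given by $T\mathcal G\oplus\langle Y\rangle=\ker\gamma$ for a smooth closed 1-form $\gamma$ on $M$. Then there is a smooth contact form $\alpha$ on $M$ with $\ker\alpha=\xi$, $i_Y\alpha\equiv1$ and $i_Yd\alpha\equiv0$ (the contact form for $\xi$ having $Y$ as its Reeb field), and $\tilde\xi:=\ker(\alpha+\gamma)$ has the following properties. (1) $\tilde\xi$ is a contact structure on $M$ transverse to $\xi$ (i.e. $\xi+\tilde\xi=TM$), and $\xi,\tilde\xi$ are commonly oriented: for local contact forms $\beta,\tilde\beta$ of $\xi,\tilde\xi$, the volume forms $\beta\wedge d\beta$ and $\tilde\beta\wedge d\tilde\beta$ are positive multiples of one another. (2) The flow of $Y$ preserves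 $\tilde\xi$. (3) For a suitable orientation of the axis $\xi\cap\tilde\xi$, the generating invariant of the pair is $I\equiv2$. Here, for a commonly oriented transverse pair with oriented axis, one chooses locally contact forms $\beta,\tilde\beta$ of $\xi,\tilde\xi$ with $\beta\wedge d\beta=\tilde\beta\wedge d\tilde\beta$ such that the vector field $X$ along the axis defined by $i_X(\beta\wedge d\beta)=\beta\wedge\tilde\beta$ is positively oriented, and $I$ is the function with $\beta\wedge d\tilde\beta+\tilde\beta\wedge d\beta=I\,\beta\wedge d\beta$. It does not depend on the choice, and changes sign with the orientation of the axis. (4) Around every point of $M$ the pair is locally of type I$_2$ with $c=2$: there are smooth local coordinates $(x,y,p)$ centred at the point in which $$\xi=\{dy=p\,dx\},\qquad \tilde\xi=\{(p+2)\,dy+dx=0\}.$$ -/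

import Mathlib

open scoped Manifold ContDiff Topology
open Bundle

noncomputable section

namespace ContactPair

/-- The model space `ℝ³`; 3-manifolds are smooth manifolds (without boundary) modelled on it. -/
abbrev R3 : Type := EuclideanSpace ℝ (Fin 3)

section Definitions

variable (M : Type*) [TopologicalSpace M] [ChartedSpace R3 M] [IsManifold (𝓡 3) ∞ M]

/-- A (not necessarily continuous) vector field. -/
abbrev VField : Type _ := (q : M) → TangentSpace (𝓡 3) q

/-- A (not necessarily continuous) 1-form. -/
abbrev OneForm : Type _ := (q : M) → (TangentSpace (𝓡 3) q →L[ℝ] ℝ)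

/-- A (not necessarily continuous) field of linear subspaces of the tangent spaces. -/
abbrev Distribution : Type _ := (q : M) → Submodule ℝ (TangentSpace (𝓡 3) q)

variable {M}

/-- Smoothness of a vector field on a subset, as a section of the tangent bundle. -/
def SmoothVFieldOn (Z : VField M) (U : Set M) : Prop :=
  ContMDiffOn (𝓡 3) (𝓡 3).tangent ∞ (fun q => (⟨q, Z q⟩ : TangentBundle (𝓡 3) M)) U

/-- Smoothness of a 1-form on a subset, as a section of the cotangent bundle. -/
def SmoothOneFormOn (α : OneForm M) (U : Set M) : Prop :=
  ContMDiffOn (𝓡 3) ((𝓡 3).prod 𝓘(ℝ, R3 →L[ℝ] ℝ)) ∞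
    (fun q => TotalSpace.mk' (R3 →L[ℝ] ℝ)
      (E := fun q : M => (TangentSpace (𝓡 3) q →L[ℝ] ℝ)) q (α q)) U

/-- The kernel of a 1-form, as a field of subspaces. -/
def kerField (α : OneForm M) : Distribution M := fun q => LinearMap.ker (α q).toLinearMap

/-- The 1-form `α` read in the preferred chart `φ` at `m`: the pull-back `(φ⁻¹)^* α`. -/
def inChart (α : OneForm M) (m : M) : R3 → (R3 →L[ℝ] ℝ) :=
  letI : ChartedSpace R3 R3 := chartedSpaceSelf R3
  fun y => (α ((extChartAt (𝓡 3) m).symm y)).comp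
      (mfderiv 𝓘(ℝ, R3) (𝓡 3) (extChartAt (𝓡 3) m).symm y)

/-- The exterior derivative `dα` of a 1-form at `m`, computed in the preferred chart at `m`
(in which `T_m M` is identified with `ℝ³`): `dα(v, w) = D_v a (w) - D_w a (v)`. -/
def extD (α : OneForm M) (m : M) (v w : TangentSpace (𝓡 3) m) : ℝ :=
  let D : R3 →L[ℝ] R3 →L[ℝ] ℝ := fderiv ℝ (inChart α m) (extChartAt (𝓡 3) m m)
  D v w - D w v

/-- `(α ∧ β)(u, v)` for 1-forms `α`, `β`. -/
def wedge (α β : OneForm M) (q : M) (u v : TangentSpace (𝓡 3) q) : ℝ :=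
  α q u * β q v - α q v * β q u

/-- The 3-form `(α ∧ dβ)(u, v, w)` for 1-forms `α`, `β`. -/
def wedgeD (α β : OneForm M) (q : M) (u v w : TangentSpace (𝓡 3) q) : ℝ :=
  α q u * extD β q v w + α q v * extD β q w u + α q w * extD β q u v

/-- `α` is a smooth contact form for `ξ` over the open set `U`: `ξ = ker α` and `α ∧ dα`
vanishes nowhere on `U`. -/
structure IsContactFormOn (ξ : Distribution M) (α : OneForm M) (U : Set M) : Prop where
  isOpen : IsOpen U
  smooth : SmoothOneFormOn α U
  ker_eq : ∀ q ∈ U, kerField α q = ξ q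
  nondegenerate : ∀ q ∈ U, ∃ u v w : TangentSpace (𝓡 3) q, wedgeD α α q u v w ≠ 0

/-- A contact structure on a 3-manifold: locally the kernel of a smooth contact form. -/
def IsContactStructure (ξ : Distribution M) : Prop :=
  ∀ m : M, ∃ U : Set M, m ∈ U ∧ ∃ α : OneForm M, IsContactFormOn ξ α U

/-- Two distributions are transverse if they span the tangent space at each point. -/
def Transverse (ξ ξ' : Distribution M) : Prop := ∀ q, ξ q ⊔ ξ' q = ⊤

/-- The orientations induced by the contact structures `ξ`, `ξ'` coincide: for all local contact
forms, `α ∧ dα` is at each point a positive multiple of `α' ∧ dα'`. -/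
def CommonlyOriented (ξ ξ' : Distribution M) : Prop :=
  ∀ (U : Set M) (α α' : OneForm M), IsContactFormOn ξ α U → IsContactFormOn ξ' α' U →
    ∀ q ∈ U, ∃ r : ℝ, 0 < r ∧ ∀ u v w : TangentSpace (𝓡 3) q,
      wedgeD α α q u v w = r * wedgeD α' α' q u v w

/-- `Φ` is a smooth local flow of `Y`, defined on the open set `U` for times in `(-ε, ε)`. -/
structure IsLocalFlow (Y : VField M) (U : Set M) (ε : ℝ) (Φ : ℝ → M → M) : Prop where
  isOpen : IsOpen U
  pos : 0 < ε
  smooth : ContMDiffOn (𝓘(ℝ, ℝ).prod (𝓡 3)) (𝓡 3) ∞ (fun z : ℝ × M => Φ z.1 z.2)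
    (Set.Ioo (-ε) ε ×ˢ U)
  zero : ∀ q ∈ U, Φ 0 q = q
  integralCurve : ∀ q ∈ U, IsMIntegralCurveOn (fun t => Φ t q) Y (Set.Ioo (-ε) ε)

/-- The flow of `Y` preserves the distribution `D`: `Y` has a local flow around each point, and
each of its local flows satisfies `(Φ_t)_* D = D`. -/
def FlowPreserves (Y : VField M) (D : Distribution M) : Prop :=
  (∀ m : M, ∃ U ε Φ, m ∈ U ∧ IsLocalFlow Y U ε Φ) ∧
  ∀ U ε Φ, IsLocalFlow Y U ε Φ → ∀ t ∈ Set.Ioo (-ε) ε, ∀ q ∈ U,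
    (D q).map (mfderiv (𝓡 3) (𝓡 3) (Φ t) q).toLinearMap = D (Φ t q)

/-- A Reeb field of `ξ`: a smooth vector field transverse to `ξ` whose flow preserves `ξ`. -/
structure IsReebField (ξ : Distribution M) (Y : VField M) : Prop where
  smooth : SmoothVFieldOn Y Set.univ
  transverse : ∀ q, Y q ∉ ξ q
  preserves : FlowPreserves Y ξ

/-- A foliation by curves, given by its tangent line field `L`: a smooth field of lines. -/
def IsLineField (L : Distribution M) : Prop :=
  ∀ m : M, ∃ U : Set M, IsOpen U ∧ m ∈ U ∧ ∃ Z : VField M, SmoothVFieldOn Z U ∧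
    ∀ q ∈ U, Z q ≠ 0 ∧ L q = Submodule.span ℝ {Z q}

/-- `Y` is a contact integrable Reeb field of `ξ`, as witnessed by the Legendrian foliation with
tangent line field `L`, which is preserved by (the flow of) `Y`. -/
structure IsContactIntegrable (ξ : Distribution M) (Y : VField M) (L : Distribution M) :
    Prop where
  reeb : IsReebField ξ Y
  lineField : IsLineField L
  legendrian : ∀ q, L q ≤ ξ q
  preserves : FlowPreserves Y L

/-- A smooth closed 1-form on `M`. -/
structure IsClosedForm (γ : OneForm M) : Prop where
  smooth : SmoothOneFormOn γ Set.univ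
  closed : ∀ (q : M) (v w : TangentSpace (𝓡 3) q), extD γ q v w = 0

/-- For a commonly oriented transverse pair `ξ`, `ξ'`: `X` is the normalized vector field along the
axis `ξ ∩ ξ'` (for the orientation of the axis that it defines), and `I` is the generating
invariant. Around each point there are balanced contact forms `α`, `α'`, i.e.
`α ∧ dα = α' ∧ dα'`, with `i_X (α ∧ dα) = α ∧ α'` and
`α ∧ dα' + α' ∧ dα = I α ∧ dα`. (Such `α`, `α'` are unique up to a common factor, so that `I` is
determined by the orientation of the axis, and reversing the latter changes its sign.) -/
def IsGeneratingInvariant (ξ ξ' : Distribution M) (X : VField M) (I : M → ℝ) : Prop :=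
  ∀ m : M, ∃ (U : Set M) (α α' : OneForm M), m ∈ U ∧
    IsContactFormOn ξ α U ∧ IsContactFormOn ξ' α' U ∧
    ∀ q ∈ U, X q ∈ ξ q ⊓ ξ' q ∧
      (∀ u v w, wedgeD α α q u v w = wedgeD α' α' q u v w) ∧
      (∀ v w, wedgeD α α q (X q) v w = wedge α α' q v w) ∧
      (∀ u v w, wedgeD α α' q u v w + wedgeD α' α q u v w = I q * wedgeD α α q u v w)

/-- The pair `ξ`, `ξ'` is around `m` of type I₂ with constant `c`: there are smooth coordinates
`φ = (x, y, p)` centred at `m` in which `ξ = {dy = p dx}` and `ξ' = {(p + c) dy + dx = 0}`. -/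
def IsTypeI2At (ξ ξ' : Distribution M) (c : ℝ) (m : M) : Prop :=
  letI : ChartedSpace ℝ ℝ := chartedSpaceSelf ℝ
  ∃ φ ∈ IsManifold.maximalAtlas (𝓡 3) ∞ M, m ∈ φ.source ∧ φ m = 0 ∧
    ∀ q ∈ φ.source, ∀ v : TangentSpace (𝓡 3) q,
      let p : ℝ := φ q 2
      let dx : ℝ := mfderiv (𝓡 3) 𝓘(ℝ, ℝ) (fun q => φ q 0) q v
      let dy : ℝ := mfderiv (𝓡 3) 𝓘(ℝ, ℝ) (fun q => φ q 1) q v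
      (v ∈ ξ q ↔ dy = p * dx) ∧ (v ∈ ξ' q ↔ (p + c) * dy + dx = 0)

end Definitions

end ContactPair

end

/-!
Cartan's formula applied to the normalized form `α` of the Reeb field `Y` gives `i_Y dα = 0`. As `Y`
is tangent to the surfaces `ker γ`, the form `α` is therefore closed along them; integrating it
there, with `γ = df` locally, yields `α = dt + p df`, so `dα = dp ∧ γ` and `α ∧ dα = dt ∧ dp ∧ γ`.
Adding the closed form `γ` changes neither `dα` nor the volume form: all four products of `α`,
`α + γ` with their differentials equal `α ∧ dα`, hence `I = 2`. Both forms are invariant under the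
flow of `Y`. Normalizing `p = 1` at the point, `x = -t`, `y = t + f` and `p⁻¹ - 1` are coordinates
of type I₂.
-/

noncomputable section

namespace ContactPair

open Filter MeasureTheory

section ExteriorDerivative

variable {E F : Type*} [NormedAddCommGroup E] [NormedSpace ℝ E] [NormedAddCommGroup F]
  [NormedSpace ℝ F]

/-- The exterior derivative of a 1-form on a normed space, as a bilinear form. -/
def dForm (a : E → E →L[ℝ] ℝ) (x : E) : E →L[ℝ] E →L[ℝ] ℝ :=
  fderiv ℝ a x - (fderiv ℝ a x).flip

theorem dForm_apply (a : E → E →L[ℝ] ℝ) (x v w : E) :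
    dForm a x v w = fderiv ℝ a x v w - fderiv ℝ a x w v := rfl

theorem dForm_self (a : E → E →L[ℝ] ℝ) (x v : E) : dForm a x v v = 0 := sub_self _

theorem dForm_congr {a b : E → E →L[ℝ] ℝ} {x : E} (h : a =ᶠ[𝓝 x] b) : dForm a x = dForm b x := by
  simp only [dForm, h.fderiv_eq]

theorem dForm_add {a b : E → E →L[ℝ] ℝ} {x : E} (ha : DifferentiableAt ℝ a x)
    (hb : DifferentiableAt ℝ b x) :
    dForm (fun y => a y + b y) x = dForm a x + dForm b x := by
  ext v w
  simp only [dForm_apply, fderiv_fun_add ha hb, add_apply]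
  ring

theorem dForm_smul {f : E → ℝ} {a : E → E →L[ℝ] ℝ} {x : E} (hf : DifferentiableAt ℝ f x)
    (ha : DifferentiableAt ℝ a x) (v w : E) :
    dForm (fun y => f y • a y) x v w =
      f x * dForm a x v w + (fderiv ℝ f x v * a x w - fderiv ℝ f x w * a x v) := by
  simp only [dForm_apply, fderiv_fun_smul hf ha, add_apply, smul_apply,
    ContinuousLinearMap.smulRight_apply, smul_eq_mul]
  ring

theorem dForm_fderiv {f : E → ℝ} {x : E} (hf : ContDiffAt ℝ 2 f x) : dForm (fderiv ℝ f) x = 0 := by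
  ext v w
  exact sub_eq_zero.2 (hf.isSymmSndFDerivAt (by simp) v w)

theorem differentiableAt_pullback {a : F → F →L[ℝ] ℝ} {f : E → F} {x : E}
    (ha : DifferentiableAt ℝ a (f x)) (hf : ContDiffAt ℝ 2 f x) :
    DifferentiableAt ℝ (fun y => (a (f y)).comp (fderiv ℝ f y)) x :=
  (ha.comp x (hf.differentiableAt (by simp))).clm_comp
    ((hf.fderiv_right (m := 1) (by norm_num)).differentiableAt (by simp))

theorem dForm_pullback {a : F → F →L[ℝ] ℝ} {f : E → F} {x : E}
    (ha : DifferentiableAt ℝ a (f x)) (hf : ContDiffAt ℝ 2 f x) (v w : E) :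
    dForm (fun y => (a (f y)).comp (fderiv ℝ f y)) x v w =
      dForm a (f x) (fderiv ℝ f x v) (fderiv ℝ f x w) := by
  have hdf : DifferentiableAt ℝ (fderiv ℝ f) x :=
    (hf.fderiv_right (m := 1) (by norm_num)).differentiableAt (by simp)
  have haf : HasFDerivAt (fun y => a (f y)) ((fderiv ℝ a (f x)).comp (fderiv ℝ f x)) x :=
    ha.hasFDerivAt.comp x (hf.differentiableAt (by simp)).hasFDerivAt
  have hsymm := hf.isSymmSndFDerivAt (by simp) v w
  simp only [dForm_apply, (haf.clm_comp hdf.hasFDerivAt).fderiv]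
  simp [hsymm]

theorem dForm_comp_inr {b : F × E → F × E →L[ℝ] ℝ} {u : F} {y : E}
    (hb : DifferentiableAt ℝ b (u, y)) (v w : E) :
    dForm (fun y => (b (u, y)).comp (ContinuousLinearMap.inr ℝ F E)) y v w =
      dForm b (u, y) (0, v) (0, w) := by
  have hinr : ∀ y, fderiv ℝ (fun y : E => (u, y)) y = ContinuousLinearMap.inr ℝ F E :=
    fun y => (hasFDerivAt_prodMk_right u y).fderiv
  simpa only [hinr, ContinuousLinearMap.inr_apply] using
    dForm_pullback (f := fun y : E => (u, y)) hb (by fun_prop) v w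

/-- Cartan's formula along a curve of maps: the term `d(i_{∂ₜΨ} a)` drops out because
`a(∂ₜΨ)` is constant. -/
theorem hasDerivAt_pullback_of_apply_const {a : F → F →L[ℝ] ℝ} {Ψ : ℝ × E → F} {t c : ℝ} {z : E}
    (ha : DifferentiableAt ℝ a (Ψ (t, z))) (hΨ : ContDiffAt ℝ 2 Ψ (t, z))
    (hc : ∀ᶠ y in 𝓝 (t, z), a (Ψ y) (fderiv ℝ Ψ y (1, 0)) = c) (w : E) :
    HasDerivAt (fun s => a (Ψ (s, z)) (fderiv ℝ Ψ (s, z) (0, w)))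
      (dForm a (Ψ (t, z)) (fderiv ℝ Ψ (t, z) (1, 0)) (fderiv ℝ Ψ (t, z) (0, w))) t := by
  let b : ℝ × E → ℝ × E →L[ℝ] ℝ := fun y => (a (Ψ y)).comp (fderiv ℝ Ψ y)
  have hb : HasFDerivAt b (fderiv ℝ b (t, z)) (t, z) :=
    (differentiableAt_pullback ha hΨ).hasFDerivAt
  have htime : fderiv ℝ b (t, z) (0, w) (1, 0) = 0 := by
    have hconst : HasFDerivAt (fun y => b y (1, 0)) (0 : ℝ × E →L[ℝ] ℝ) (t, z) :=
      (hasFDerivAt_const c (t, z)).congr_of_eventuallyEq hc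
    have hflip : HasFDerivAt (fun y => b y (1, 0)) ((fderiv ℝ b (t, z)).flip (1, 0)) (t, z) := by
      simpa using hb.clm_apply (hasFDerivAt_const ((1 : ℝ), (0 : E)) (t, z))
    exact DFunLike.congr_fun (hflip.unique hconst) (0, w)
  have hcurve : HasDerivAt (fun s => ((s, z) : ℝ × E)) (1, 0) t :=
    (hasDerivAt_id t).prodMk (hasDerivAt_const t z)
  have hspace : HasDerivAt (fun s => b (s, z) (0, w)) (fderiv ℝ b (t, z) (1, 0) (0, w)) t := by
    simpa using (HasFDerivAt.comp_hasDerivAt (l := b) t hb hcurve).clm_apply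
      (hasDerivAt_const t ((0 : ℝ), w))
  rw [← dForm_pullback ha hΨ, dForm_apply, htime, sub_zero]
  exact hspace

end ExteriorDerivative

section ParametricIntegral

variable {H G : Type*} [NormedAddCommGroup H] [NormedSpace ℝ H] [FiniteDimensional ℝ H]
  [NormedAddCommGroup G] [NormedSpace ℝ G]

theorem hasFDerivAt_intervalIntegral_of_contDiff {f : H × ℝ → G} (hf : ContDiff ℝ 1 f) (x : H) :
    HasFDerivAt (fun x => ∫ t in (0 : ℝ)..1, f (x, t))
      (∫ t in (0 : ℝ)..1, (fderiv ℝ f (x, t)).comp (ContinuousLinearMap.inl ℝ H ℝ)) x := by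
  have hc : Continuous f := hf.continuous
  have hf' : Continuous fun z => (fderiv ℝ f z).comp (ContinuousLinearMap.inl ℝ H ℝ) :=
    (hf.continuous_fderiv (by simp)).clm_comp continuous_const
  have : ProperSpace H := FiniteDimensional.proper_real H
  obtain ⟨C, hC⟩ := ((isCompact_closedBall x 1).prod
    (isCompact_Icc (a := (0 : ℝ)) (b := 1))).exists_bound_of_continuousOn hf'.continuousOn
  refine intervalIntegral.hasFDerivAt_integral_of_dominated_of_fderiv_le
    (F := fun x t => f (x, t)) (bound := fun _ => C)
    (F' := fun x t => (fderiv ℝ f (x, t)).comp (ContinuousLinearMap.inl ℝ H ℝ))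
    (Metric.closedBall_mem_nhds x one_pos) ?_ ?_ ?_ ?_ ?_ ?_
  · exact Eventually.of_forall fun y => (hc.comp (by fun_prop)).aestronglyMeasurable
  · exact (hc.comp (by fun_prop : Continuous fun t : ℝ => (x, t))).intervalIntegrable _ _
  · exact (hf'.comp (by fun_prop : Continuous fun t : ℝ => (x, t))).aestronglyMeasurable
  · refine Eventually.of_forall fun t ht y hy => hC (y, t) ⟨hy, ?_⟩
    rw [Set.uIoc_of_le zero_le_one] at ht
    exact ⟨ht.1.le, ht.2⟩
  · exact intervalIntegrable_const
  · exact Eventually.of_forall fun t _ y _ =>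
      (hf.differentiable (by simp) _).hasFDerivAt.comp y (hasFDerivAt_prodMk_left y t)

theorem contDiff_intervalIntegral {f : H × ℝ → G} {n : ℕ} (hf : ContDiff ℝ n f) :
    ContDiff ℝ n (fun x => ∫ t in (0 : ℝ)..1, f (x, t)) := by
  induction n generalizing f with
  | zero =>
    have hc : Continuous f := hf.continuous
    simp only [CharP.cast_eq_zero, contDiff_zero]
    exact intervalIntegral.continuous_parametric_intervalIntegral_of_continuous' (by exact hc) 0 1
  | succ n ih =>
    have hf1 : ContDiff ℝ 1 f := hf.of_le (by norm_cast; lia)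
    rw [Nat.cast_succ, contDiff_succ_iff_fderiv_apply]
    refine ⟨fun x => (hasFDerivAt_intervalIntegral_of_contDiff hf1 x).differentiableAt,
      by simp, fun y => ?_⟩
    have hdf : ContDiff ℝ n fun z => fderiv ℝ f z (y, 0) :=
      (hf.fderiv_right (m := n) (by norm_cast)).clm_apply contDiff_const
    convert ih hdf using 2 with x
    rw [(hasFDerivAt_intervalIntegral_of_contDiff hf1 x).fderiv,
      ContinuousLinearMap.intervalIntegral_apply]
    · rfl
    · exact (((hf1.continuous_fderiv (by simp)).clm_comp continuous_const).comp
        (by fun_prop : Continuous fun t : ℝ => (x, t))).intervalIntegrable _ _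

end ParametricIntegral

section Primitives

variable {E : Type*} [NormedAddCommGroup E] [NormedSpace ℝ E]

theorem exists_contDiff_eventuallyEq [HasContDiffBump E] {F : Type*} [NormedAddCommGroup F]
    [NormedSpace ℝ F] {f : E → F} {x : E} (hf : ∀ᶠ y in 𝓝 x, ContDiffAt ℝ ∞ f y) :
    ∃ g : E → F, ContDiff ℝ ∞ g ∧ g =ᶠ[𝓝 x] f := by
  obtain ⟨r, hr, hball⟩ := Metric.eventually_nhds_iff_ball.1 hf
  let χ : ContDiffBump x := ⟨r / 3, r / 2, by positivity, by linarith⟩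
  refine ⟨fun y => χ y • f y, contDiff_iff_contDiffAt.2 fun y => ?_, ?_⟩
  · by_cases hy : y ∈ Metric.ball x r
    · exact χ.contDiffAt.smul (hball y hy)
    · have hsupp : y ∈ (tsupport χ)ᶜ := fun h => hy <| by
        rw [χ.tsupport_eq] at h
        exact Metric.closedBall_subset_ball (half_lt_self hr) h
      refine contDiffAt_const (c := (0 : F)) |>.congr_of_eventuallyEq ?_
      filter_upwards [(isClosed_tsupport χ).isOpen_compl.mem_nhds hsupp] with z hz
      rw [image_eq_zero_of_notMem_tsupport hz, zero_smul]
  · filter_upwards [χ.eventuallyEq_one] with y hy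
    rw [hy, Pi.one_apply, one_smul]

theorem exists_local_primitive {g : E → E →L[ℝ] ℝ} {z₀ : E}
    (hg : ∀ᶠ z in 𝓝 z₀, ContDiffAt ℝ ∞ g z) (hdg : ∀ᶠ z in 𝓝 z₀, dForm g z = 0) :
    ∃ f : E → ℝ, ∀ᶠ z in 𝓝 z₀, ContDiffAt ℝ ∞ f z ∧ fderiv ℝ f z = g z := by
  obtain ⟨r, hr, hball⟩ := Metric.eventually_nhds_iff_ball.1 (hg.and hdg)
  obtain ⟨f, hf⟩ := (convex_ball z₀ r).exists_forall_hasFDerivAt_of_fderiv_symmetric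
    Metric.isOpen_ball
    (fun z hz => ((hball z hz).1.differentiableAt (by simp)).differentiableWithinAt)
    (fun z hz v w => sub_eq_zero.1 (DFunLike.congr_fun (DFunLike.congr_fun (hball z hz).2 v) w))
  have hsmooth : ContDiffOn ℝ ∞ f (Metric.ball z₀ r) :=
    (contDiffOn_infty_iff_fderiv_of_isOpen Metric.isOpen_ball).2
      ⟨fun z hz => (hf z hz).differentiableAt.differentiableWithinAt, fun z hz =>
        (hball z hz).1.contDiffWithinAt.congr (fun y hy => (hf y hy).fderiv) (hf z hz).fderiv⟩
  refine ⟨f, ?_⟩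
  filter_upwards [Metric.ball_mem_nhds z₀ hr] with z hz
  exact ⟨hsmooth.contDiffAt (Metric.isOpen_ball.mem_nhds hz), (hf z hz).fderiv⟩

theorem hasFDerivAt_integral_radial {b : E → E →L[ℝ] ℝ} {r : ℝ}
    (hb : DifferentiableOn ℝ b (Metric.ball 0 r)) (hd : ∀ x ∈ Metric.ball 0 r, dForm b x = 0)
    {x : E} (hx : x ∈ Metric.ball 0 r) :
    HasFDerivAt (fun x => ∫ s in (0 : ℝ)..1, b (s • x) x) (b x) x := by
  obtain ⟨f, hf⟩ := (convex_ball (0 : E) r).exists_forall_hasFDerivAt_of_fderiv_symmetric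
    Metric.isOpen_ball hb
    (fun x hx v w => sub_eq_zero.1 (DFunLike.congr_fun (DFunLike.congr_fun (hd x hx) v) w))
  refine ((hf x hx).sub_const (f 0)).congr_of_eventuallyEq ?_
  filter_upwards [Metric.isOpen_ball.mem_nhds hx] with y hy
  have hray : ∀ s ∈ Set.uIcc (0 : ℝ) 1, s • y ∈ Metric.ball (0 : E) r := fun s hs => by
    rw [Set.uIcc_of_le zero_le_one] at hs
    exact (convex_ball (0 : E) r).smul_mem_of_zero_mem
      (Metric.mem_ball_self (Metric.pos_of_mem_ball hy)) hy hs
  have hsmul : ∀ s : ℝ, HasDerivAt (fun s => s • y) y s := fun s => by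
    simpa using (hasDerivAt_id s).smul_const y
  rw [intervalIntegral.integral_eq_sub_of_hasDerivAt (f := fun s => f (s • y))
    (fun s hs => (hf _ (hray s hs)).comp_hasDerivAt s (hsmul s))]
  · simp
  · refine ContinuousOn.intervalIntegrable ?_
    exact (hb.continuousOn.comp (by fun_prop) hray).clm_apply continuousOn_const

/-- The primitive is the radial integral `∫₀¹ b (u, s x) (0, x) ds` of Poincaré's lemma on each
leaf, with the transverse coordinate `u` as a parameter. -/
theorem exists_leafwise_primitive [FiniteDimensional ℝ E] {b : ℝ × E → ℝ × E →L[ℝ] ℝ} {u₀ : ℝ}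
    (hb : ∀ᶠ z in 𝓝 (u₀, (0 : E)), ContDiffAt ℝ ∞ b z)
    (hd : ∀ᶠ z in 𝓝 (u₀, (0 : E)), ∀ v w : E, dForm b z (0, v) (0, w) = 0) :
    ∃ T : ℝ × E → ℝ, ContDiff ℝ ∞ T ∧
      ∀ᶠ z in 𝓝 (u₀, (0 : E)), ∀ v : E, fderiv ℝ T z (0, v) = b z (0, v) := by
  obtain ⟨b', hb', hbb'⟩ := exists_contDiff_eventuallyEq hb
  let f : (ℝ × E) × ℝ → ℝ := fun q => b' (q.1.1, q.2 • q.1.2) (0, q.1.2)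
  have hf : ContDiff ℝ ∞ f :=
    (hb'.comp (by fun_prop : ContDiff ℝ ∞ fun q : (ℝ × E) × ℝ => (q.1.1, q.2 • q.1.2))).clm_apply
      (by fun_prop : ContDiff ℝ ∞ fun q : (ℝ × E) × ℝ => ((0 : ℝ), q.1.2))
  have hT : ContDiff ℝ ∞ fun z => ∫ s in (0 : ℝ)..1, f (z, s) := contDiff_infty.2 fun n =>
    contDiff_intervalIntegral (hf.of_le (by exact_mod_cast le_top))
  refine ⟨_, hT, ?_⟩
  obtain ⟨r, hr, hball⟩ := Metric.eventually_nhds_iff_ball.1 (hbb'.eventuallyEq_nhds.and hd)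
  filter_upwards [Metric.ball_mem_nhds _ hr] with ⟨u, x⟩ hz v
  obtain ⟨hu, hx⟩ : u ∈ Metric.ball u₀ r ∧ x ∈ Metric.ball 0 r := by
    rwa [← ball_prod_same] at hz
  have hdb' : Differentiable ℝ b' := hb'.differentiable (by simp)
  let β : E → E →L[ℝ] ℝ := fun y => (b' (u, y)).comp (ContinuousLinearMap.inr ℝ ℝ E)
  have hβ : Differentiable ℝ β :=
    (hdb'.comp (by fun_prop : Differentiable ℝ fun y : E => (u, y))).clm_comp
      (differentiable_const _)
  have hdβ : ∀ y ∈ Metric.ball 0 r, dForm β y = 0 := fun y hy => by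
    obtain ⟨hbb, hclosed⟩ := hball (u, y) (by rw [← ball_prod_same]; exact ⟨hu, hy⟩)
    rw [← dForm_congr hbb] at hclosed
    ext v w
    exact (dForm_comp_inr (hdb' _) v w).trans (hclosed v w)
  have hleaf := hasFDerivAt_integral_radial hβ.differentiableOn hdβ hx
  have hchain := (hT.differentiable (by simp) (u, x)).hasFDerivAt.comp x
    (hasFDerivAt_prodMk_right u x)
  have hb'b := (hball (u, x) hz).1.self_of_nhds
  rw [← hb'b]
  exact DFunLike.congr_fun (hchain.unique hleaf) v

end Primitives

section Straightening

variable {E F : Type*} [NormedAddCommGroup E] [NormedSpace ℝ E] [NormedAddCommGroup F]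
  [NormedSpace ℝ F]

theorem fderiv_symm_comp_fderiv {e : OpenPartialHomeomorph E F} {x : E} (hx : x ∈ e.source)
    (he : DifferentiableAt ℝ e x) (he' : DifferentiableAt ℝ e.symm (e x)) :
    (fderiv ℝ e.symm (e x)).comp (fderiv ℝ e x) = ContinuousLinearMap.id ℝ E :=
  (he'.hasFDerivAt.comp x he.hasFDerivAt).unique
    ((hasFDerivAt_id x).congr_of_eventuallyEq (e.eventually_left_inverse hx))

/-- The inverse function theorem, with the source shrunk so that the inverse is smooth on the whole
target and not only at the image of the base point. -/
theorem exists_openPartialHomeomorph_contDiffOn [CompleteSpace E] {f : E → F} {x : E}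
    (hf : ∀ᶠ z in 𝓝 x, ContDiffAt ℝ ∞ f z) (hinv : (fderiv ℝ f x).IsInvertible) :
    ∃ e : OpenPartialHomeomorph E F, x ∈ e.source ∧ (e : E → F) = f ∧
      ContDiffOn ℝ ∞ e e.source ∧ ContDiffOn ℝ ∞ e.symm e.target := by
  obtain ⟨e', he'⟩ := hinv
  have hx := hf.self_of_nhds
  have hn : (∞ : ℕ∞ω) ≠ 0 := by simp
  have hd : HasFDerivAt f (e' : E →L[ℝ] F) x := by
    rw [he']; exact (hx.differentiableAt hn).hasFDerivAt
  let e₀ := hx.toOpenPartialHomeomorph f hd hn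
  have hinv : ∀ᶠ z in 𝓝 x, fderiv ℝ f z ∈ Set.range ((↑) : (E ≃L[ℝ] F) → E →L[ℝ] F) :=
    hx.continuousAt_fderiv hn (by rw [← he']; exact ContinuousLinearEquiv.nhds e')
  obtain ⟨O, hO, hOo, hxO⟩ := mem_nhds_iff.1 (hf.and hinv)
  refine ⟨e₀.restrOpen O hOo, ⟨hx.mem_toOpenPartialHomeomorph_source hd hn, hxO⟩, rfl,
    fun z hz => (hO hz.2).1.contDiffWithinAt, fun w hw => ?_⟩
  have hz := (e₀.restrOpen O hOo).map_target hw
  obtain ⟨hfz, e₁, he₁⟩ := hO hz.2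
  refine ((e₀.restrOpen O hOo).contDiffAt_symm hw (f₀' := e₁) ?_ hfz).contDiffWithinAt
  rw [he₁]
  exact (hfz.differentiableAt hn).hasFDerivAt

theorem exists_straightening [CompleteSpace E] {f : E → ℝ} {x : E}
    (hf : ∀ᶠ z in 𝓝 x, ContDiffAt ℝ ∞ f z) (hdf : fderiv ℝ f x ≠ 0) :
    ∃ e : OpenPartialHomeomorph E (ℝ × (fderiv ℝ f x).ker),
      x ∈ e.source ∧ e x = (f x, 0) ∧ (∀ z, (e z).1 = f z) ∧
      ContDiffOn ℝ ∞ e e.source ∧ ContDiffOn ℝ ∞ e.symm e.target := by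
  obtain ⟨P, hP⟩ := ContinuousLinearMap.ker_closedComplemented_of_finiteDimensional_range
    (fderiv ℝ f x)
  have hPsurj : P.range = ⊤ := LinearMap.range_eq_top.2 fun k => ⟨k, hP k⟩
  have hdsurj : (fderiv ℝ f x).range = ⊤ :=
    LinearMap.range_eq_top.2 <| LinearMap.surjective fun h =>
      hdf (ContinuousLinearMap.coe_injective h)
  let κ : E → ℝ × (fderiv ℝ f x).ker := fun z => (f z, P (z - x))
  have hκ : ∀ᶠ z in 𝓝 x, ContDiffAt ℝ ∞ κ z := by
    filter_upwards [hf] with z hz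
    exact hz.prodMk (P.contDiff.contDiffAt.comp z (contDiffAt_id.sub contDiffAt_const))
  have hκ' : fderiv ℝ κ x = (fderiv ℝ f x).prod P :=
    (((hf.self_of_nhds.differentiableAt (by simp)).hasFDerivAt).prodMk
      (P.hasFDerivAt.comp x ((hasFDerivAt_id x).sub_const x))).fderiv
  obtain ⟨e, hx, he, hes, hei⟩ := exists_openPartialHomeomorph_contDiffOn hκ
    ⟨ContinuousLinearMap.equivProdOfSurjectiveOfIsCompl (fderiv ℝ f x) P hdsurj hPsurj
      (LinearMap.isCompl_of_proj hP), hκ'.symm⟩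
  exact ⟨e, hx, by simp [he, κ], fun z => by rw [he], hes, hei⟩

theorem fderiv_fderiv_symm_inr {e : OpenPartialHomeomorph E (ℝ × F)} {f : E → ℝ}
    (hef : ∀ z, (e z).1 = f z) {w : ℝ × F} (hw : w ∈ e.target)
    (hf : DifferentiableAt ℝ f (e.symm w)) (he : DifferentiableAt ℝ e.symm w) (v : F) :
    fderiv ℝ f (e.symm w) (fderiv ℝ e.symm w (0, v)) = 0 := by
  have hfst : (fun w => f (e.symm w)) =ᶠ[𝓝 w] Prod.fst := by
    filter_upwards [e.open_target.mem_nhds hw] with y hy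
    rw [← hef, e.right_inv hy]
  have hcomp := (hf.hasFDerivAt.comp w he.hasFDerivAt).unique
    (hasFDerivAt_fst.congr_of_eventuallyEq hfst)
  exact DFunLike.congr_fun hcomp (0, v)

theorem fderiv_comp_eq_of_fderiv_eq_zero {e : OpenPartialHomeomorph E (ℝ × F)} {f : E → ℝ}
    (hef : ∀ z, (e z).1 = f z) {z : E} (hz : z ∈ e.source) (he : DifferentiableAt ℝ e z)
    (he' : DifferentiableAt ℝ e.symm (e z)) {T : ℝ × F → ℝ} (hT : DifferentiableAt ℝ T (e z))
    {l : E →L[ℝ] ℝ} (hTl : ∀ v, fderiv ℝ T (e z) (0, v) = l (fderiv ℝ e.symm (e z) (0, v)))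
    {v : E} (hv : fderiv ℝ f z v = 0) : fderiv ℝ (T ∘ e) z v = l v := by
  have hleaf : fderiv ℝ e z v = (0, (fderiv ℝ e z v).2) := by
    have hfst := he.hasFDerivAt.fst
    simp only [hef] at hfst
    exact Prod.ext ((DFunLike.congr_fun hfst.fderiv v).symm.trans hv) rfl
  rw [fderiv_comp z hT he, ContinuousLinearMap.comp_apply, hleaf, hTl, ← hleaf]
  exact congrArg l (DFunLike.congr_fun (fderiv_symm_comp_fderiv hz he he') v)

theorem exists_primitive_along_levels [FiniteDimensional ℝ E] {a : E → E →L[ℝ] ℝ} {f : E → ℝ}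
    {z₀ : E} (ha : ∀ᶠ z in 𝓝 z₀, ContDiffAt ℝ ∞ a z) (hf : ∀ᶠ z in 𝓝 z₀, ContDiffAt ℝ ∞ f z)
    (hda : ∀ᶠ z in 𝓝 z₀, ∀ v w, fderiv ℝ f z v = 0 → fderiv ℝ f z w = 0 → dForm a z v w = 0)
    (hdf : fderiv ℝ f z₀ ≠ 0) :
    ∃ t : E → ℝ, ∀ᶠ z in 𝓝 z₀, ContDiffAt ℝ ∞ t z ∧
      ∀ v, fderiv ℝ f z v = 0 → fderiv ℝ t z v = a z v := by
  have hn : (∞ : ℕ∞ω) ≠ 0 := by simp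
  have : CompleteSpace E := FiniteDimensional.complete ℝ E
  obtain ⟨e, hz₀, hez₀, hef, hes, hei⟩ := exists_straightening hf hdf
  replace hes {z} (hz : z ∈ e.source) := hes.contDiffAt (e.open_source.mem_nhds hz)
  replace hei {w} (hw : w ∈ e.target) := hei.contDiffAt (e.open_target.mem_nhds hw)
  have htgt : ∀ᶠ w in 𝓝 (e z₀), w ∈ e.target := e.open_target.mem_nhds (e.map_source hz₀)
  have hsymm : Tendsto e.symm (𝓝 (e z₀)) (𝓝 z₀) := e.tendsto_symm hz₀
  rw [hez₀] at htgt hsymm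
  obtain ⟨T, hT, hTb⟩ := exists_leafwise_primitive (u₀ := f z₀)
    (b := fun w => (a (e.symm w)).comp (fderiv ℝ e.symm w))
    (by
      filter_upwards [htgt, hsymm.eventually ha] with w hw haw
      exact (haw.comp w (hei hw)).clm_comp ((hei hw).fderiv_right (by simp)))
    (by
      filter_upwards [htgt, hsymm.eventually ha, hsymm.eventually hf, hsymm.eventually hda]
        with w hw haw hfw hdw v v'
      have hlevel := fderiv_fderiv_symm_inr hef hw (hfw.differentiableAt hn)
        ((hei hw).differentiableAt hn)
      rw [dForm_pullback (haw.differentiableAt hn) ((hei hw).of_le ENat.LEInfty.out)]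
      exact hdw _ _ (hlevel v) (hlevel v'))
  rw [← hez₀] at hTb
  refine ⟨T ∘ e, ?_⟩
  filter_upwards [e.open_source.mem_nhds hz₀, (e.continuousAt hz₀).eventually hTb] with z hz hTz
  refine ⟨hT.contDiffAt.comp z (hes hz), fun v hv => ?_⟩
  refine fderiv_comp_eq_of_fderiv_eq_zero hef hz ((hes hz).differentiableAt hn)
    ((hei (e.map_source hz)).differentiableAt hn) (hT.differentiable hn _) (fun v => ?_) hv
  rw [hTz, e.left_inv hz, ContinuousLinearMap.comp_apply]

end Straightening

section ClebschPotentials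

variable {E : Type*} [NormedAddCommGroup E] [NormedSpace ℝ E]

/-- `t`, `p`, `f` are Clebsch potentials of the 1-form `a` near `z₀`: smooth functions with
`a = dt + p df`. -/
structure HasClebschPotentials (a : E → E →L[ℝ] ℝ) (t p f : E → ℝ) (z₀ : E) : Prop where
  smooth_t : ∀ᶠ z in 𝓝 z₀, ContDiffAt ℝ ∞ t z
  smooth_p : ∀ᶠ z in 𝓝 z₀, ContDiffAt ℝ ∞ p z
  smooth_f : ∀ᶠ z in 𝓝 z₀, ContDiffAt ℝ ∞ f z
  eq : ∀ᶠ z in 𝓝 z₀, a z = fderiv ℝ t z + p z • fderiv ℝ f z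

theorem eq_div_smul_of_ker_le {V : Type*} [AddCommGroup V] [Module ℝ V] [TopologicalSpace V]
    {φ ψ : V →L[ℝ] ℝ} (h : ∀ v, ψ v = 0 → φ v = 0) {e : V} (he : ψ e ≠ 0) :
    φ = (φ e / ψ e) • ψ := by
  ext v
  have hv := h (v - (ψ v / ψ e) • e) (by simp [he])
  simp only [map_sub, map_smul, smul_eq_mul, sub_eq_zero] at hv
  simp only [smul_apply, smul_eq_mul, hv]
  ring

theorem exists_hasClebschPotentials [FiniteDimensional ℝ E] {a : E → E →L[ℝ] ℝ}
    {f : E → ℝ} {z₀ : E}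
    (ha : ∀ᶠ z in 𝓝 z₀, ContDiffAt ℝ ∞ a z) (hf : ∀ᶠ z in 𝓝 z₀, ContDiffAt ℝ ∞ f z)
    (hda : ∀ᶠ z in 𝓝 z₀, ∀ v w, fderiv ℝ f z v = 0 → fderiv ℝ f z w = 0 → dForm a z v w = 0)
    (hf₀ : fderiv ℝ f z₀ ≠ 0) :
    ∃ t p : E → ℝ, HasClebschPotentials a t p f z₀ := by
  obtain ⟨t, ht⟩ := exists_primitive_along_levels ha hf hda hf₀
  obtain ⟨e₁, he₁⟩ : ∃ e₁, fderiv ℝ f z₀ e₁ ≠ 0 := DFunLike.ne_iff.1 hf₀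
  have hne : ∀ᶠ z in 𝓝 z₀, fderiv ℝ f z e₁ ≠ 0 :=
    ((hf.self_of_nhds.continuousAt_fderiv (by simp)).clm_apply continuousAt_const).eventually_ne he₁
  refine ⟨t, fun z => (a z - fderiv ℝ t z) e₁ / fderiv ℝ f z e₁, ht.mono fun z hz => hz.1,
    ?_, hf, ?_⟩
  · filter_upwards [ha, hf, ht, hne] with z haz hfz htz hnz
    exact ((haz.sub (htz.1.fderiv_right (by simp))).clm_apply contDiffAt_const).div
      ((hfz.fderiv_right (m := ∞) (by simp)).clm_apply contDiffAt_const) hnz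
  · filter_upwards [ht, hne] with z htz hnz
    have hker : ∀ v, fderiv ℝ f z v = 0 → (a z - fderiv ℝ t z) v = 0 := fun v hv =>
      sub_eq_zero.2 (htz.2 v hv).symm
    rw [← eq_div_smul_of_ker_le hker hnz, add_sub_cancel]

variable {a : E → E →L[ℝ] ℝ} {t p f : E → ℝ} {z₀ : E}

theorem HasClebschPotentials.dForm_apply (h : HasClebschPotentials a t p f z₀) (v w : E) :
    dForm a z₀ v w = fderiv ℝ p z₀ v * fderiv ℝ f z₀ w - fderiv ℝ p z₀ w * fderiv ℝ f z₀ v := by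
  have ht : ContDiffAt ℝ 2 t z₀ := h.smooth_t.self_of_nhds.of_le ENat.LEInfty.out
  have hf : ContDiffAt ℝ 2 f z₀ := h.smooth_f.self_of_nhds.of_le ENat.LEInfty.out
  have hp : DifferentiableAt ℝ p z₀ := h.smooth_p.self_of_nhds.differentiableAt (by simp)
  have hdt : DifferentiableAt ℝ (fderiv ℝ t) z₀ :=
    (ht.fderiv_right (m := 1) (by norm_num)).differentiableAt (by simp)
  have hdf : DifferentiableAt ℝ (fderiv ℝ f) z₀ :=
    (hf.fderiv_right (m := 1) (by norm_num)).differentiableAt (by simp)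
  rw [dForm_congr h.eq, dForm_add (b := fun z => p z • fderiv ℝ f z) hdt (hp.smul hdf), add_apply,
    add_apply, dForm_smul hp hdf, dForm_fderiv ht, dForm_fderiv hf]
  simp

/-- The freedom `(t, p, f) ↦ (t + c f + const, p - c, f + const)` in the choice of Clebsch
potentials. -/
theorem HasClebschPotentials.normalize (h : HasClebschPotentials a t p f z₀) (c t₀ f₀ : ℝ) :
    HasClebschPotentials a (fun z => t z + c * f z - t₀) (fun z => p z - c) (fun z => f z - f₀)
      z₀ where
  smooth_t := by
    filter_upwards [h.smooth_t, h.smooth_f] with z ht hf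
    exact (ht.add (contDiffAt_const.mul hf)).sub contDiffAt_const
  smooth_p := h.smooth_p.mono fun z hp => hp.sub contDiffAt_const
  smooth_f := h.smooth_f.mono fun z hf => hf.sub contDiffAt_const
  eq := by
    filter_upwards [h.smooth_t, h.smooth_f, h.eq] with z ht hf hz
    have hf' := hf.differentiableAt (n := ∞) (by simp)
    rw [fderiv_sub_const, fderiv_sub_const, fderiv_fun_add (ht.differentiableAt (by simp))
      (hf'.const_mul c), fderiv_const_mul hf', hz]
    module

end ClebschPotentials

section TripleWedge

variable {K V : Type*} [Field K]

/-- The 3-form `a ∧ b ∧ c` of three functionals. -/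
def tripleWedge (a b c : V → K) (u v w : V) : K :=
  Matrix.det !![a u, a v, a w; b u, b v, b w; c u, c v, c w]

theorem tripleWedge_apply (a b c : V → K) (u v w : V) :
    tripleWedge a b c u v w = a u * (b v * c w - b w * c v) + a v * (b w * c u - b u * c w) +
      a w * (b u * c v - b v * c u) := by
  simp only [tripleWedge, Matrix.det_fin_three, Matrix.of_apply, Matrix.cons_val]
  ring

variable [AddCommGroup V] [Module K V]

theorem exists_apply_eq_of_tripleWedge_ne_zero (a b c : V →ₗ[K] K) {u v w : V}
    (h : tripleWedge a b c u v w ≠ 0) (r s t : K) : ∃ x, a x = r ∧ b x = s ∧ c x = t := by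
  set A := !![a u, a v, a w; b u, b v, b w; c u, c v, c w]
  obtain ⟨x, hx⟩ : ∃ x, A.mulVec x = ![r, s, t] :=
    Matrix.mulVec_surjective_iff_isUnit.2 ((Matrix.isUnit_iff_isUnit_det A).2 h.isUnit) _
  have hrow (i : Fin 3) : A i 0 * x 0 + A i 1 * x 1 + A i 2 * x 2 = ![r, s, t] i := by
    rw [← hx, Matrix.mulVec, dotProduct, Fin.sum_univ_three]
  refine ⟨x 0 • u + x 1 • v + x 2 • w, ?_, ?_, ?_⟩ <;>
    simp only [map_add, map_smul, smul_eq_mul, mul_comm (x _)]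
  exacts [hrow 0, hrow 1, hrow 2]

end TripleWedge

section TypeI2Coordinates

variable {E : Type*} {t p f : E → ℝ} {z : E}

/-- The map `(x, y, p)` given by Clebsch potentials `t`, `p`, `f` of `a` that is a chart of type I₂
for the pair `ker a`, `ker (a + df)`: on `ker a` one has `dt = -p df`, hence `dx = p df` and
`dy = (1 - p) df`. -/
def typeI2Chart (t p f : E → ℝ) (z : E) : R3 := !₂[-t z, t z + f z, (p z)⁻¹ - 1]

theorem typeI2Chart_eq_zero (ht : t z = 0) (hp : p z = 1) (hf : f z = 0) :
    typeI2Chart t p f z = 0 := by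
  ext i
  fin_cases i <;> simp [typeI2Chart, ht, hp, hf]

variable [NormedAddCommGroup E] [NormedSpace ℝ E] {a : E → E →L[ℝ] ℝ} {z₀ : E}

theorem contDiffAt_typeI2Chart {n : ℕ∞ω} (ht : ContDiffAt ℝ n t z) (hp : ContDiffAt ℝ n p z)
    (hf : ContDiffAt ℝ n f z) (hpz : p z ≠ 0) : ContDiffAt ℝ n (typeI2Chart t p f) z := by
  rw [contDiffAt_euclidean]
  intro i
  fin_cases i
  exacts [ht.neg, ht.add hf, (hp.inv hpz).sub contDiffAt_const]

theorem fderiv_typeI2Chart_apply (ht : DifferentiableAt ℝ t z) (hp : DifferentiableAt ℝ p z)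
    (hf : DifferentiableAt ℝ f z) (hpz : p z ≠ 0) (v : E) :
    fderiv ℝ (typeI2Chart t p f) z v =
      !₂[-fderiv ℝ t z v, fderiv ℝ t z v + fderiv ℝ f z v, -(p z ^ 2)⁻¹ * fderiv ℝ p z v] := by
  have hχ : DifferentiableAt ℝ (typeI2Chart t p f) z := by
    rw [differentiableAt_euclidean]
    intro i
    fin_cases i
    exacts [ht.neg, ht.add hf, (hp.inv hpz).sub_const 1]
  have hcoord (i : Fin 3) :=
    (EuclideanSpace.proj i : R3 →L[ℝ] ℝ).hasFDerivAt.comp z hχ.hasFDerivAt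
  ext i
  fin_cases i
  · exact DFunLike.congr_fun ((hcoord 0).unique ht.hasFDerivAt.neg) v
  · exact DFunLike.congr_fun ((hcoord 1).unique (ht.hasFDerivAt.add hf.hasFDerivAt)) v
  · exact DFunLike.congr_fun ((hcoord 2).unique
      (((hasDerivAt_inv hpz).comp_hasFDerivAt z hp.hasFDerivAt).sub_const 1)) v

theorem HasClebschPotentials.eventually_typeI2Chart (h : HasClebschPotentials a t p f z₀)
    (hp : p z₀ ≠ 0) : ∀ᶠ z in 𝓝 z₀, ContDiffAt ℝ ∞ (typeI2Chart t p f) z ∧ ∀ v,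
      (a z v = 0 ↔ fderiv ℝ (typeI2Chart t p f) z v 1 =
        typeI2Chart t p f z 2 * fderiv ℝ (typeI2Chart t p f) z v 0) ∧
      (a z v + fderiv ℝ f z v = 0 ↔ (typeI2Chart t p f z 2 + 2) *
        fderiv ℝ (typeI2Chart t p f) z v 1 + fderiv ℝ (typeI2Chart t p f) z v 0 = 0) := by
  filter_upwards [h.smooth_t, h.smooth_p, h.smooth_f, h.eq,
    h.smooth_p.self_of_nhds.continuousAt.eventually_ne hp] with z htz hpz hfz haz hpz₀
  refine ⟨contDiffAt_typeI2Chart htz hpz hfz hpz₀, fun v => ?_⟩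
  rw [fderiv_typeI2Chart_apply (htz.differentiableAt (by simp)) (hpz.differentiableAt (by simp))
    (hfz.differentiableAt (by simp)) hpz₀, haz]
  simp only [typeI2Chart, add_apply, smul_apply, smul_eq_mul, Matrix.cons_val]
  constructor <;> constructor <;> intro hv <;> field_simp at hv ⊢ <;> linarith

theorem HasClebschPotentials.surjective_fderiv_typeI2Chart (h : HasClebschPotentials a t p f z₀)
    (hp : p z₀ ≠ 0)
    (hdet : ∃ u v w, tripleWedge (a z₀) (fderiv ℝ p z₀) (fderiv ℝ f z₀) u v w ≠ 0) :
    Function.Surjective (fderiv ℝ (typeI2Chart t p f) z₀) := by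
  obtain ⟨u, v, w, huvw⟩ := hdet
  intro y
  obtain ⟨x, hax, hpx, hfx⟩ := exists_apply_eq_of_tripleWedge_ne_zero (a z₀).toLinearMap
    (fderiv ℝ p z₀).toLinearMap (fderiv ℝ f z₀).toLinearMap huvw
    (-y 0 + p z₀ * (y 0 + y 1)) (-(p z₀ ^ 2) * y 2) (y 0 + y 1)
  simp only [ContinuousLinearMap.coe_coe] at hax hpx hfx
  have htx : fderiv ℝ t z₀ x = -y 0 := by
    rw [h.eq.self_of_nhds, add_apply, smul_apply, smul_eq_mul, hfx] at hax
    linarith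
  refine ⟨x, ?_⟩
  rw [fderiv_typeI2Chart_apply (h.smooth_t.self_of_nhds.differentiableAt (by simp))
    (h.smooth_p.self_of_nhds.differentiableAt (by simp))
    (h.smooth_f.self_of_nhds.differentiableAt (by simp)) hp, htx, hpx, hfx]
  ext i
  fin_cases i <;> simp [hp]

theorem HasClebschPotentials.exists_typeI2_coordinates {a : R3 → R3 →L[ℝ] ℝ} {t p f : R3 → ℝ}
    {z₀ : R3} (h : HasClebschPotentials a t p f z₀)
    (hdet : ∃ u v w, tripleWedge (a z₀) (fderiv ℝ p z₀) (fderiv ℝ f z₀) u v w ≠ 0) :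
    ∃ e : OpenPartialHomeomorph R3 R3, z₀ ∈ e.source ∧ e z₀ = 0 ∧
      ContDiffOn ℝ ∞ e e.source ∧ ContDiffOn ℝ ∞ e.symm e.target ∧
      ∀ᶠ z in 𝓝 z₀, ∀ v, (a z v = 0 ↔ fderiv ℝ e z v 1 = e z 2 * fderiv ℝ e z v 0) ∧
        (a z v + fderiv ℝ f z v = 0 ↔
          (e z 2 + 2) * fderiv ℝ e z v 1 + fderiv ℝ e z v 0 = 0) := by
  let t₁ : R3 → ℝ := fun z => t z + (p z₀ - 1) * f z - (t z₀ + (p z₀ - 1) * f z₀)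
  let p₁ : R3 → ℝ := fun z => p z - (p z₀ - 1)
  let f₁ : R3 → ℝ := fun z => f z - f z₀
  have hn : HasClebschPotentials a t₁ p₁ f₁ z₀ := h.normalize (p z₀ - 1) _ (f z₀)
  have hp₁ : p₁ z₀ = 1 := by simp [p₁]
  have hp₀ : p₁ z₀ ≠ 0 := hp₁ ▸ one_ne_zero
  have hdp : fderiv ℝ p₁ = fderiv ℝ p := funext fun _ => fderiv_sub_const _
  have hdf : fderiv ℝ f₁ = fderiv ℝ f := funext fun _ => fderiv_sub_const _
  have hχ := hn.eventually_typeI2Chart hp₀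
  have hsurj := hn.surjective_fderiv_typeI2Chart hp₀ (by rwa [hdp, hdf])
  have hinv : (fderiv ℝ (typeI2Chart t₁ p₁ f₁) z₀).IsInvertible :=
    ⟨(LinearEquiv.ofBijective (fderiv ℝ (typeI2Chart t₁ p₁ f₁) z₀).toLinearMap
      ⟨LinearMap.injective_iff_surjective.2 hsurj, hsurj⟩).toContinuousLinearEquiv, rfl⟩
  obtain ⟨e, hz₀, he, hsmooth, hsymm⟩ :=
    exists_openPartialHomeomorph_contDiffOn (hχ.mono fun z hz => hz.1) hinv
  refine ⟨e, hz₀, ?_, hsmooth, hsymm, ?_⟩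
  · rw [he]
    exact typeI2Chart_eq_zero (sub_self _) hp₁ (sub_self _)
  · rw [he, ← hdf]
    exact hχ.mono fun z hz => hz.2

end TypeI2Coordinates

section Charts

variable {M : Type*} [TopologicalSpace M] [ChartedSpace R3 M]

/-- The derivative at `q` of the preferred chart at `m`. -/
def dChart (m q : M) : TangentSpace (𝓡 3) q →L[ℝ] R3 :=
  mfderiv (𝓡 3) 𝓘(ℝ, R3) (extChartAt (𝓡 3) m) q

/-- The derivative of the inverse of the preferred chart at `m`. -/
def dChartSymm (m : M) (z : R3) : R3 →L[ℝ] TangentSpace (𝓡 3) ((extChartAt (𝓡 3) m).symm z) :=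
  mfderiv 𝓘(ℝ, R3) (𝓡 3) (extChartAt (𝓡 3) m).symm z

theorem inChart_apply (α : OneForm M) (m : M) (z v : R3) :
    inChart α m z v = α ((extChartAt (𝓡 3) m).symm z) (dChartSymm m z v) := rfl

theorem extD_eq_dForm_inChart (α : OneForm M) (m : M) (v w : TangentSpace (𝓡 3) m) :
    extD α m v w = dForm (inChart α m) (extChartAt (𝓡 3) m m) v w := rfl

variable [IsManifold (𝓡 3) ∞ M] {α : OneForm M} {m q : M} {z : R3}

theorem dChartSymm_dChart (hz : z ∈ (extChartAt (𝓡 3) m).target)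
    (v : TangentSpace (𝓡 3) ((extChartAt (𝓡 3) m).symm z)) :
    dChartSymm m z (dChart m ((extChartAt (𝓡 3) m).symm z) v) = v := by
  have h := mfderivWithin_extChartAt_symm_comp_mfderiv_extChartAt (I := 𝓡 3) hz
  rw [ModelWithCorners.range_eq_univ, mfderivWithin_univ] at h
  exact DFunLike.congr_fun h v

theorem inChart_dChart (α : OneForm M) (hq : q ∈ (extChartAt (𝓡 3) m).source)
    (v : TangentSpace (𝓡 3) q) :
    inChart α m (extChartAt (𝓡 3) m q) (dChart m q v) = α q v := by
  obtain ⟨z, hz, rfl⟩ : ∃ z ∈ (extChartAt (𝓡 3) m).target, (extChartAt (𝓡 3) m).symm z = q :=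
    ⟨_, (extChartAt (𝓡 3) m).map_source hq, (extChartAt (𝓡 3) m).left_inv hq⟩
  rw [(extChartAt (𝓡 3) m).right_inv hz, inChart_apply, dChartSymm_dChart hz]

theorem dChart_self (m : M) (v : TangentSpace (𝓡 3) m) : dChart m m v = v :=
  DFunLike.congr_fun (mfderiv_extChartAt_self (I := 𝓡 3) (x := m)) v

theorem inChart_self (α : OneForm M) (m : M) (v : TangentSpace (𝓡 3) m) :
    inChart α m (extChartAt (𝓡 3) m m) v = α m v := by
  rw [← inChart_dChart α (mem_extChartAt_source m) v, dChart_self]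

theorem dChart_surjective (hq : q ∈ (extChartAt (𝓡 3) m).source) :
    Function.Surjective (dChart m q) :=
  (isInvertible_mfderiv_extChartAt hq).bijective.surjective

theorem contMDiffAt_extChartAt_symm (hz : z ∈ (extChartAt (𝓡 3) m).target) :
    ContMDiffAt 𝓘(ℝ, R3) (𝓡 3) ∞ (extChartAt (𝓡 3) m).symm z :=
  (contMDiffOn_extChartAt_symm m).contMDiffAt ((isOpen_extChartAt_target m).mem_nhds hz)

theorem contMDiffAt_extChartAt_of_mem (hq : q ∈ (extChartAt (𝓡 3) m).source) :
    ContMDiffAt (𝓡 3) 𝓘(ℝ, R3) ∞ (extChartAt (𝓡 3) m) q :=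
  contMDiffAt_extChartAt' (by rwa [extChartAt_source] at hq)

theorem hasMFDerivAt_extChartAt_dChart (hq : q ∈ (extChartAt (𝓡 3) m).source) :
    HasMFDerivAt (𝓡 3) 𝓘(ℝ, R3) (extChartAt (𝓡 3) m) q (dChart m q) :=
  ((contMDiffAt_extChartAt_of_mem hq).mdifferentiableAt (by simp)).hasMFDerivAt

theorem hasMFDerivAt_extChartAt_symm_dChartSymm (hz : z ∈ (extChartAt (𝓡 3) m).target) :
    HasMFDerivAt 𝓘(ℝ, R3) (𝓡 3) (extChartAt (𝓡 3) m).symm z (dChartSymm m z) :=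
  ((contMDiffAt_extChartAt_symm hz).mdifferentiableAt (by simp)).hasMFDerivAt

theorem contDiffAt_inChart {U : Set M} (hα : SmoothOneFormOn α U)
    (hz : z ∈ (extChartAt (𝓡 3) m).target) (hU : U ∈ 𝓝 ((extChartAt (𝓡 3) m).symm z)) :
    ContDiffAt ℝ ∞ (inChart α m) z := by
  have hmem {y : R3} (hy : y ∈ (extChartAt (𝓡 3) m).target) :
      (extChartAt (𝓡 3) m).symm y ∈ (chartAt R3 m).source := by
    rw [← extChartAt_source (𝓡 3)]
    exact (extChartAt (𝓡 3) m).map_target hy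
  let e := trivializationAt (R3 →L[ℝ] ℝ)
    (fun q : M => TangentSpace (𝓡 3) q →L[ℝ] (Bundle.Trivial M ℝ q)) m
  have hbase : (extChartAt (𝓡 3) m).symm z ∈ e.baseSet := by
    simp only [e, hom_trivializationAt_baseSet]
    exact ⟨hmem hz, Set.mem_univ _⟩
  have htriv : ContMDiffAt (𝓡 3) 𝓘(ℝ, R3 →L[ℝ] ℝ) ∞ (fun x => (e ⟨x, α x⟩).2)
      ((extChartAt (𝓡 3) m).symm z) :=
    (Trivialization.contMDiffAt_section_iff e hbase).1 (hα.contMDiffAt hU)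
  refine (htriv.comp z (contMDiffAt_extChartAt_symm hz)).contDiffAt.congr_of_eventuallyEq ?_
  filter_upwards [(isOpen_extChartAt_target m).mem_nhds hz] with y hy
  have hsymmL := TangentBundle.symmL_trivializationAt (I := 𝓡 3) (hmem hy)
  rw [ModelWithCorners.range_eq_univ, mfderivWithin_univ,
    (extChartAt (𝓡 3) m).right_inv hy] at hsymmL
  ext v
  rw [inChart_apply]
  simp only [e, hom_trivializationAt_apply, ContinuousLinearMap.inCoordinates,
    ContinuousLinearMap.comp_apply, hsymmL, Function.comp_apply]
  simp only [dChartSymm, Trivial.fiberBundle_trivializationAt',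
    Trivial.continuousLinearMapAt_trivialization]
  rfl

theorem differentiableAt_inChart (hα : SmoothOneFormOn α Set.univ)
    (hq : q ∈ (extChartAt (𝓡 3) m).source) :
    DifferentiableAt ℝ (inChart α m) (extChartAt (𝓡 3) m q) :=
  (contDiffAt_inChart hα ((extChartAt (𝓡 3) m).map_source hq) univ_mem).differentiableAt (by simp)

theorem inChart_eq_pullback (α : OneForm M) (hz : z ∈ (extChartAt (𝓡 3) q).target)
    (hz' : (extChartAt (𝓡 3) q).symm z ∈ (extChartAt (𝓡 3) m).source) :
    inChart α q z = (inChart α m (extChartAt (𝓡 3) m ((extChartAt (𝓡 3) q).symm z))).comp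
      (fderiv ℝ (extChartAt (𝓡 3) m ∘ (extChartAt (𝓡 3) q).symm) z) := by
  refine ContinuousLinearMap.ext fun v => (inChart_dChart α hz' (dChartSymm q z v)).symm.trans ?_
  have hτ := ((hasMFDerivAt_extChartAt_dChart hz').comp z
    (hasMFDerivAt_extChartAt_symm_dChartSymm hz)).mfderiv
  rw [mfderiv_eq_fderiv] at hτ
  exact congrArg (inChart α m _) (DFunLike.congr_fun hτ v).symm

theorem dForm_inChart_dChart (hα : SmoothOneFormOn α Set.univ)
    (hq : q ∈ (extChartAt (𝓡 3) m).source) (v w : TangentSpace (𝓡 3) q) :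
    dForm (inChart α m) (extChartAt (𝓡 3) m q) (dChart m q v) (dChart m q w) = extD α q v w := by
  set τ : R3 → R3 := extChartAt (𝓡 3) m ∘ (extChartAt (𝓡 3) q).symm
  have hqq : (extChartAt (𝓡 3) q).symm (extChartAt (𝓡 3) q q) = q := extChartAt_to_inv q
  have hτq : τ (extChartAt (𝓡 3) q q) = extChartAt (𝓡 3) m q :=
    congrArg (extChartAt (𝓡 3) m) hqq
  have hτ : ContDiffAt ℝ ∞ τ (extChartAt (𝓡 3) q q) :=
    (ContMDiffAt.comp _ (by rw [hqq]; exact contMDiffAt_extChartAt_of_mem hq)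
      (contMDiffAt_extChartAt_symm (mem_extChartAt_target q))).contDiffAt
  have hdτ (u : TangentSpace (𝓡 3) q) : fderiv ℝ τ (extChartAt (𝓡 3) q q) u = dChart m q u := by
    have hcomp := (hτ.differentiableAt (by simp)).hasFDerivAt.hasMFDerivAt.comp q
      (hasMFDerivAt_extChartAt_dChart (mem_extChartAt_source q))
    have hev : extChartAt (𝓡 3) m =ᶠ[𝓝 q] τ ∘ extChartAt (𝓡 3) q := by
      filter_upwards [extChartAt_source_mem_nhds (I := 𝓡 3) q] with x hx
      simp only [τ, Function.comp_apply, (extChartAt (𝓡 3) q).left_inv hx]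
    have h := DFunLike.congr_fun (hcomp.congr_of_eventuallyEq hev).mfderiv u
    exact (h.trans (congrArg (fderiv ℝ τ _) (dChart_self q u))).symm
  have hpull : inChart α q =ᶠ[𝓝 (extChartAt (𝓡 3) q q)]
      fun y => (inChart α m (τ y)).comp (fderiv ℝ τ y) := by
    filter_upwards [extChartAt_target_mem_nhds (I := 𝓡 3) q,
      (continuousAt_extChartAt_symm (I := 𝓡 3) q).eventually
        ((isOpen_extChartAt_source m).mem_nhds (by rwa [hqq]))] with y hy hy'
    exact inChart_eq_pullback α hy hy'
  have hd := dForm_pullback (by rw [hτq]; exact differentiableAt_inChart hα hq)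
    (hτ.of_le ENat.LEInfty.out) v w
  rw [← dForm_congr hpull, hτq] at hd
  rw [← hdτ, ← hdτ]
  exact hd.symm

end Charts

section Flows

variable {M : Type*} [TopologicalSpace M] [ChartedSpace R3 M] {Y : VField M} {U : Set M} {ε : ℝ}
  {Φ : ℝ → M → M} {t : ℝ} {q m : M}

theorem IsLocalFlow.zero_mem (hΦ : IsLocalFlow Y U ε Φ) : (0 : ℝ) ∈ Set.Ioo (-ε) ε :=
  ⟨neg_neg_iff_pos.2 hΦ.pos, hΦ.pos⟩

theorem IsLocalFlow.contMDiffAt (hΦ : IsLocalFlow Y U ε Φ) (ht : t ∈ Set.Ioo (-ε) ε)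
    (hq : q ∈ U) :
    ContMDiffAt (𝓘(ℝ, ℝ).prod (𝓡 3)) (𝓡 3) ∞ (fun z : ℝ × M => Φ z.1 z.2) (t, q) :=
  hΦ.smooth.contMDiffAt (prod_mem_nhds (isOpen_Ioo.mem_nhds ht) (hΦ.isOpen.mem_nhds hq))

theorem IsLocalFlow.hasMFDerivAt_space (hΦ : IsLocalFlow Y U ε Φ) (ht : t ∈ Set.Ioo (-ε) ε)
    (hq : q ∈ U) :
    HasMFDerivAt (𝓡 3) (𝓡 3) (Φ t) q (mfderiv (𝓡 3) (𝓡 3) (Φ t) q) :=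
  (((hΦ.contMDiffAt ht hq).comp q
    (contMDiffAt_const.prodMk contMDiffAt_id)).mdifferentiableAt (by simp)).hasMFDerivAt

theorem IsLocalFlow.hasMFDerivAt_time (hΦ : IsLocalFlow Y U ε Φ) (ht : t ∈ Set.Ioo (-ε) ε)
    (hq : q ∈ U) :
    HasMFDerivAt 𝓘(ℝ, ℝ) (𝓡 3) (fun t => Φ t q) t ((1 : ℝ →L[ℝ] ℝ).smulRight (Y (Φ t q))) :=
  (hΦ.integralCurve q hq t ht).hasMFDerivAt (isOpen_Ioo.mem_nhds ht)

theorem IsLocalFlow.mfderiv_zero (hΦ : IsLocalFlow Y U ε Φ) (hq : q ∈ U)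
    (v : TangentSpace (𝓡 3) q) : mfderiv (𝓡 3) (𝓡 3) (Φ 0) q v = v := by
  have hid : Φ 0 =ᶠ[𝓝 q] id := eventually_of_mem (hΦ.isOpen.mem_nhds hq) hΦ.zero
  exact DFunLike.congr_fun ((hasMFDerivAt_id q).congr_of_eventuallyEq hid).mfderiv v

/-- The flow read in the preferred charts at `q` and `m`. -/
def flowInCharts (Φ : ℝ → M → M) (q m : M) : ℝ × R3 → R3 :=
  fun x => extChartAt (𝓡 3) m (Φ x.1 ((extChartAt (𝓡 3) q).symm x.2))

variable {q' : M}

theorem flowInCharts_extChartAt (hq' : q' ∈ (extChartAt (𝓡 3) q).source) :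
    flowInCharts Φ q m (t, extChartAt (𝓡 3) q q') = extChartAt (𝓡 3) m (Φ t q') := by
  rw [flowInCharts, (extChartAt (𝓡 3) q).left_inv hq']

theorem IsLocalFlow.eventually_mem_source (hΦ : IsLocalFlow Y U ε Φ) (ht : t ∈ Set.Ioo (-ε) ε)
    (hq : q ∈ U) (hm : Φ t q ∈ (extChartAt (𝓡 3) m).source) :
    ∀ᶠ x in 𝓝 (t, q), x.1 ∈ Set.Ioo (-ε) ε ∧ x.2 ∈ U ∧
      Φ x.1 x.2 ∈ (extChartAt (𝓡 3) m).source :=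
  (continuousAt_fst.eventually (isOpen_Ioo.mem_nhds ht)).and
    ((continuousAt_snd.eventually (hΦ.isOpen.mem_nhds hq)).and
      ((hΦ.contMDiffAt ht hq).continuousAt.eventually
        ((isOpen_extChartAt_source m).mem_nhds hm)))

variable [IsManifold (𝓡 3) ∞ M]

theorem IsLocalFlow.contDiffAt_flowInCharts (hΦ : IsLocalFlow Y U ε Φ)
    (ht : t ∈ Set.Ioo (-ε) ε) (hU : q' ∈ U) (hq' : q' ∈ (extChartAt (𝓡 3) q).source)
    (hm : Φ t q' ∈ (extChartAt (𝓡 3) m).source) :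
    ContDiffAt ℝ ∞ (flowInCharts Φ q m) (t, extChartAt (𝓡 3) q q') := by
  have hin : ContMDiffAt 𝓘(ℝ, ℝ × R3) (𝓘(ℝ, ℝ).prod (𝓡 3)) ∞
      (fun x : ℝ × R3 => (x.1, (extChartAt (𝓡 3) q).symm x.2)) (t, extChartAt (𝓡 3) q q') :=
    contDiffAt_fst.contMDiffAt.prodMk
      ((contMDiffAt_extChartAt_symm ((extChartAt (𝓡 3) q).map_source hq')).comp
        (t, extChartAt (𝓡 3) q q') contDiffAt_snd.contMDiffAt)
  have hinv := (extChartAt (𝓡 3) q).left_inv hq'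
  have hflow : ContMDiffAt 𝓘(ℝ, ℝ × R3) (𝓡 3) ∞
      (fun x : ℝ × R3 => Φ x.1 ((extChartAt (𝓡 3) q).symm x.2)) (t, extChartAt (𝓡 3) q q') :=
    ContMDiffAt.comp (g := fun z : ℝ × M => Φ z.1 z.2) _
      (by rw [hinv]; exact hΦ.contMDiffAt ht hU) hin
  exact (ContMDiffAt.comp _ (by rw [hinv]; exact contMDiffAt_extChartAt_of_mem hm)
    hflow).contDiffAt

theorem IsLocalFlow.hasFDerivAt_flowInCharts (hΦ : IsLocalFlow Y U ε Φ)
    (ht : t ∈ Set.Ioo (-ε) ε) (hU : q' ∈ U) (hq' : q' ∈ (extChartAt (𝓡 3) q).source)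
    (hm : Φ t q' ∈ (extChartAt (𝓡 3) m).source) :
    HasFDerivAt (flowInCharts Φ q m)
      (fderiv ℝ (flowInCharts Φ q m) (t, extChartAt (𝓡 3) q q')) (t, extChartAt (𝓡 3) q q') :=
  ((hΦ.contDiffAt_flowInCharts ht hU hq' hm).differentiableAt (by simp)).hasFDerivAt

theorem IsLocalFlow.fderiv_flowInCharts_time (hΦ : IsLocalFlow Y U ε Φ)
    (ht : t ∈ Set.Ioo (-ε) ε) (hU : q' ∈ U) (hq' : q' ∈ (extChartAt (𝓡 3) q).source)
    (hm : Φ t q' ∈ (extChartAt (𝓡 3) m).source) :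
    fderiv ℝ (flowInCharts Φ q m) (t, extChartAt (𝓡 3) q q') (1, 0) =
      dChart m (Φ t q') (Y (Φ t q')) := by
  have hpartial : HasFDerivAt (fun s => flowInCharts Φ q m (s, extChartAt (𝓡 3) q q')) _ t :=
    HasFDerivAt.comp (g := flowInCharts Φ q m) t
      (hΦ.hasFDerivAt_flowInCharts ht hU hq' hm) (hasFDerivAt_prodMk_left t _)
  have hcurve := (hasMFDerivAt_extChartAt_dChart hm).comp t (hΦ.hasMFDerivAt_time ht hU)
  have heq : (fun s => flowInCharts Φ q m (s, extChartAt (𝓡 3) q q')) =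
      extChartAt (𝓡 3) m ∘ fun s => Φ s q' := funext fun s => flowInCharts_extChartAt hq'
  rw [← heq] at hcurve
  refine (DFunLike.congr_fun (hasMFDerivAt_unique hpartial.hasMFDerivAt hcurve) (1 : ℝ)).trans ?_
  exact congrArg (dChart m (Φ t q')) (one_smul ℝ _)

theorem IsLocalFlow.fderiv_flowInCharts_space (hΦ : IsLocalFlow Y U ε Φ)
    (ht : t ∈ Set.Ioo (-ε) ε) (hU : q' ∈ U) (hq' : q' ∈ (extChartAt (𝓡 3) q).source)
    (hm : Φ t q' ∈ (extChartAt (𝓡 3) m).source) (v : TangentSpace (𝓡 3) q') :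
    fderiv ℝ (flowInCharts Φ q m) (t, extChartAt (𝓡 3) q q') (0, dChart q q' v) =
      dChart m (Φ t q') (mfderiv (𝓡 3) (𝓡 3) (Φ t) q' v) := by
  have hpartial : HasFDerivAt (fun z => flowInCharts Φ q m (t, z)) _ (extChartAt (𝓡 3) q q') :=
    HasFDerivAt.comp (g := flowInCharts Φ q m) _
      (hΦ.hasFDerivAt_flowInCharts ht hU hq' hm) (hasFDerivAt_prodMk_right t _)
  have hspace := (hasMFDerivAt_extChartAt_dChart hm).comp q' (hΦ.hasMFDerivAt_space ht hU)
  have heq : (fun z => flowInCharts Φ q m (t, z)) ∘ extChartAt (𝓡 3) q =ᶠ[𝓝 q']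
      extChartAt (𝓡 3) m ∘ Φ t :=
    eventually_of_mem ((isOpen_extChartAt_source q).mem_nhds hq') fun _ => flowInCharts_extChartAt
  exact DFunLike.congr_fun (hasMFDerivAt_unique
    (hpartial.hasMFDerivAt.comp q' (hasMFDerivAt_extChartAt_dChart hq'))
    (hspace.congr_of_eventuallyEq heq)) v

theorem IsLocalFlow.eventually_inChart_fderiv_flowInCharts (hΦ : IsLocalFlow Y U ε Φ)
    {α : OneForm M} {c : ℝ} (hαY : ∀ q, α q (Y q) = c) (ht : t ∈ Set.Ioo (-ε) ε) (hq : q ∈ U)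
    (hm : Φ t q ∈ (extChartAt (𝓡 3) m).source) :
    ∀ᶠ y in 𝓝 (t, extChartAt (𝓡 3) q q),
      inChart α m (flowInCharts Φ q m y) (fderiv ℝ (flowInCharts Φ q m) y (1, 0)) = c := by
  have hsymm : Tendsto (fun y : ℝ × R3 => (y.1, (extChartAt (𝓡 3) q).symm y.2))
      (𝓝 (t, extChartAt (𝓡 3) q q)) (𝓝 (t, q)) := by
    have h := (continuousAt_extChartAt_symm (I := 𝓡 3) q).tendsto
    rw [extChartAt_to_inv] at h
    exact continuousAt_fst.prodMk_nhds (h.comp continuousAt_snd)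
  filter_upwards [hsymm.eventually (hΦ.eventually_mem_source ht hq hm),
    continuousAt_snd.eventually (extChartAt_target_mem_nhds (I := 𝓡 3) q)]
    with ⟨s, y⟩ ⟨hs, hU, hsm⟩ hy
  obtain ⟨q', hq', rfl⟩ : ∃ q' ∈ (extChartAt (𝓡 3) q).source, extChartAt (𝓡 3) q q' = y :=
    ⟨_, (extChartAt (𝓡 3) q).map_target hy, (extChartAt (𝓡 3) q).right_inv hy⟩
  simp only [(extChartAt (𝓡 3) q).left_inv hq'] at hs hU hsm
  rw [hΦ.fderiv_flowInCharts_time hs hU hq' hsm, flowInCharts_extChartAt hq',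
    inChart_dChart α hsm, hαY]

theorem IsLocalFlow.hasDerivAt_pullback (hΦ : IsLocalFlow Y U ε Φ) {α : OneForm M} {c : ℝ}
    (hα : SmoothOneFormOn α Set.univ) (hαY : ∀ q, α q (Y q) = c) (ht : t ∈ Set.Ioo (-ε) ε)
    (hq : q ∈ U) (v : TangentSpace (𝓡 3) q) :
    HasDerivAt (fun s => α (Φ s q) (mfderiv (𝓡 3) (𝓡 3) (Φ s) q v))
      (extD α (Φ t q) (Y (Φ t q)) (mfderiv (𝓡 3) (𝓡 3) (Φ t) q v)) t := by
  have hqs := mem_extChartAt_source (I := 𝓡 3) q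
  have hm := mem_extChartAt_source (I := 𝓡 3) (Φ t q)
  have hder := hasDerivAt_pullback_of_apply_const
    (by rw [flowInCharts_extChartAt hqs]; exact differentiableAt_inChart hα hm)
    ((hΦ.contDiffAt_flowInCharts ht hq hqs hm).of_le ENat.LEInfty.out)
    (hΦ.eventually_inChart_fderiv_flowInCharts hαY ht hq hm) (dChart q q v)
  rw [hΦ.fderiv_flowInCharts_time ht hq hqs hm, hΦ.fderiv_flowInCharts_space ht hq hqs hm,
    flowInCharts_extChartAt hqs, dForm_inChart_dChart hα hm] at hder
  refine hder.congr_of_eventuallyEq ?_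
  filter_upwards [(Continuous.prodMk_left q).continuousAt.eventually
    (hΦ.eventually_mem_source ht hq hm)] with s ⟨hs, _, hsm⟩
  rw [hΦ.fderiv_flowInCharts_space hs hq hqs hsm, flowInCharts_extChartAt hqs,
    inChart_dChart α hsm]

end Flows

section OneForms

variable {M : Type*} [TopologicalSpace M] [ChartedSpace R3 M] {α β γ : OneForm M} {Y : VField M}
  {U : Set M} {q : M}

theorem mem_kerField {v : TangentSpace (𝓡 3) q} : v ∈ kerField α q ↔ α q v = 0 := Iff.rfl

theorem eq_apply_smul_of_kerField_eq (h : kerField β q = kerField α q)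
    {y : TangentSpace (𝓡 3) q} (hy : α q y = 1) : β q = β q y • α q := by
  have hle (v) (hv : α q v = 0) : β q v = 0 := mem_kerField.1 (h ▸ mem_kerField.2 hv)
  have hβ := eq_div_smul_of_ker_le hle (e := y) (by rw [hy]; exact one_ne_zero)
  rwa [hy, div_one] at hβ

theorem extD_congr (h : ∀ᶠ x in 𝓝 q, α x = β x) : extD α q = extD β q := by
  have hchart : inChart α q =ᶠ[𝓝 (extChartAt (𝓡 3) q q)] inChart β q := by
    have hsymm := (continuousAt_extChartAt_symm (I := 𝓡 3) q).tendsto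
    rw [extChartAt_to_inv] at hsymm
    filter_upwards [hsymm.eventually h] with z hz
    simp only [inChart, hz]
  funext v w
  rw [extD_eq_dForm_inChart, extD_eq_dForm_inChart, dForm_congr hchart]

variable [IsManifold (𝓡 3) ∞ M]

theorem SmoothOneFormOn.add (hα : SmoothOneFormOn α U) (hβ : SmoothOneFormOn β U) :
    SmoothOneFormOn (fun q => α q + β q) U :=
  ContMDiffOn.add_section hα hβ

theorem SmoothOneFormOn.contMDiffAt_apply (hα : SmoothOneFormOn α U) (hY : SmoothVFieldOn Y U)
    (hU : U ∈ 𝓝 q) : ContMDiffAt (𝓡 3) 𝓘(ℝ, ℝ) ∞ (fun q => α q (Y q)) q :=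
  (contMDiffAt_totalSpace.1 (ContMDiffAt.clm_bundle_apply (F₁ := R3)
    (E₁ := fun q : M => TangentSpace (𝓡 3) q) (F₂ := ℝ) (E₂ := Bundle.Trivial M ℝ)
    (b := fun q : M => q) (hα.contMDiffAt hU) (hY.contMDiffAt hU))).2

theorem extD_add (hα : SmoothOneFormOn α Set.univ) (hβ : SmoothOneFormOn β Set.univ)
    (v w : TangentSpace (𝓡 3) q) :
    extD (fun q => α q + β q) q v w = extD α q v w + extD β q v w := by
  have hq := mem_extChartAt_source (I := 𝓡 3) q
  have h := dForm_add (differentiableAt_inChart hα hq) (differentiableAt_inChart hβ hq)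
  exact DFunLike.congr_fun (DFunLike.congr_fun h v) w

theorem extD_smul {f : M → ℝ} {df : R3 →L[ℝ] ℝ}
    (hf : HasMFDerivAt (𝓡 3) 𝓘(ℝ, ℝ) f q df) (hα : SmoothOneFormOn α Set.univ)
    (v w : TangentSpace (𝓡 3) q) :
    extD (fun q => f q • α q) q v w =
      f q * extD α q v w + (df v * α q w - df w * α q v) := by
  have hfq : HasFDerivAt (f ∘ (extChartAt (𝓡 3) q).symm) df (extChartAt (𝓡 3) q q) := by
    have hwritten := hf.2
    simp only [writtenInExtChartAt, extChartAt_model_space_eq_id, PartialEquiv.refl_coe,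
      Function.id_comp, modelWithCornersSelf_coe, Set.range_id] at hwritten
    exact hasFDerivWithinAt_univ.1 hwritten
  have h := dForm_smul hfq.differentiableAt
    (differentiableAt_inChart hα (mem_extChartAt_source q)) v w
  rw [hfq.fderiv, inChart_self, inChart_self, Function.comp_apply, extChartAt_to_inv] at h
  exact h

theorem wedgeD_smul_self {f : M → ℝ} (hf : MDifferentiableAt (𝓡 3) 𝓘(ℝ, ℝ) f q)
    (hα : SmoothOneFormOn α Set.univ) (u v w : TangentSpace (𝓡 3) q) :
    wedgeD (fun q => f q • α q) (fun q => f q • α q) q u v w =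
      f q ^ 2 * wedgeD α α q u v w := by
  simp only [wedgeD, extD_smul hf.hasMFDerivAt hα, smul_apply, smul_eq_mul]
  ring

end OneForms

section ReebForms

variable {M : Type*} [TopologicalSpace M] [ChartedSpace R3 M] {α α' β γ : OneForm M} {Y : VField M}
  {U : Set M} {ε : ℝ} {Φ : ℝ → M → M} {t : ℝ} {q : M}

theorem wedgeD_self_congr (h : ∀ᶠ x in 𝓝 q, α x = β x) : wedgeD α α q = wedgeD β β q := by
  funext u v w
  simp only [wedgeD, extD_congr h, h.self_of_nhds]

variable [IsManifold (𝓡 3) ∞ M]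

/-- A smooth 1-form with `α(Y) = 1` and `i_Y dα = 0`; if `α` is a contact form, this says that `Y`
is its Reeb field. -/
structure IsReebForm (Y : VField M) (α : OneForm M) : Prop where
  smooth : SmoothOneFormOn α Set.univ
  apply_field : ∀ q, α q (Y q) = 1
  extD_field : ∀ q v, extD α q (Y q) v = 0

theorem IsContactFormOn.apply_field_ne_zero (hβ : IsContactFormOn (kerField α) β U)
    (hαY : ∀ q, α q (Y q) = 1) (hq : q ∈ U) : β q (Y q) ≠ 0 := fun h => by
  have hmem : Y q ∈ kerField α q := hβ.ker_eq q hq ▸ mem_kerField.2 h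
  exact one_ne_zero ((hαY q).symm.trans (mem_kerField.1 hmem))

theorem IsReebForm.add_isClosedForm (hα : IsReebForm Y α) (hγ : IsClosedForm γ)
    (hγY : ∀ q, γ q (Y q) = 0) : IsReebForm Y (fun q => α q + γ q) where
  smooth := hα.smooth.add hγ.smooth
  apply_field q := by rw [add_apply, hα.apply_field, hγY, add_zero]
  extD_field q v := by rw [extD_add hα.smooth hγ.smooth, hα.extD_field, hγ.closed, add_zero]

theorem IsReebForm.pullback_eq (hα : IsReebForm Y α) (hΦ : IsLocalFlow Y U ε Φ)
    (ht : t ∈ Set.Ioo (-ε) ε) (hq : q ∈ U) (v : TangentSpace (𝓡 3) q) :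
    α (Φ t q) (mfderiv (𝓡 3) (𝓡 3) (Φ t) q v) = α q v := by
  have hderiv (s) (hs : s ∈ Set.Ioo (-ε) ε) :
      HasDerivAt (fun s => α (Φ s q) (mfderiv (𝓡 3) (𝓡 3) (Φ s) q v)) 0 s := by
    have h := hΦ.hasDerivAt_pullback hα.smooth hα.apply_field hs hq v
    rwa [hα.extD_field] at h
  have hzero : α (Φ 0 q) (mfderiv (𝓡 3) (𝓡 3) (Φ 0) q v) = α q v := by
    rw [hΦ.mfderiv_zero hq v, hΦ.zero q hq]
  rw [← hzero]
  exact isOpen_Ioo.is_const_of_deriv_eq_zero isPreconnected_Ioo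
    (fun s hs => (hderiv s hs).differentiableAt.differentiableWithinAt)
    (fun s hs => (hderiv s hs).deriv) ht hΦ.zero_mem

theorem extD_field_eq_zero_of_mem_kerField (hα : SmoothOneFormOn α Set.univ)
    (hαY : ∀ q, α q (Y q) = 1) (h : FlowPreserves Y (kerField α)) {v : TangentSpace (𝓡 3) q}
    (hv : v ∈ kerField α q) : extD α q (Y q) v = 0 := by
  obtain ⟨U, ε, Φ, hq, hΦ⟩ := h.1 q
  have hconst : (fun s => α (Φ s q) (mfderiv (𝓡 3) (𝓡 3) (Φ s) q v)) =ᶠ[𝓝 0] fun _ => 0 := by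
    filter_upwards [isOpen_Ioo.mem_nhds hΦ.zero_mem] with s hs
    have hmem := Submodule.mem_map_of_mem (f := (mfderiv (𝓡 3) (𝓡 3) (Φ s) q).toLinearMap) hv
    rw [h.2 U ε Φ hΦ s hs q hq] at hmem
    exact hmem
  have hderiv := (hΦ.hasDerivAt_pullback hα hαY hΦ.zero_mem hq v).unique
    ((hasDerivAt_const 0 (0 : ℝ)).congr_of_eventuallyEq hconst)
  rwa [hΦ.mfderiv_zero hq v, hΦ.zero q hq] at hderiv

theorem FlowPreserves.isReebForm (h : FlowPreserves Y (kerField α))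
    (hα : SmoothOneFormOn α Set.univ) (hαY : ∀ q, α q (Y q) = 1) : IsReebForm Y α := by
  refine ⟨hα, hαY, fun q v => ?_⟩
  have hself : dForm (inChart α q) (extChartAt (𝓡 3) q q) (Y q) (Y q) = 0 := dForm_self _ _ _
  have hker : dForm (inChart α q) (extChartAt (𝓡 3) q q) (Y q) v =
      dForm (inChart α q) (extChartAt (𝓡 3) q q) (Y q) (Y q) / α q (Y q) * α q v :=
    DFunLike.congr_fun (eq_div_smul_of_ker_le
      (fun w hw => extD_field_eq_zero_of_mem_kerField hα hαY h hw)
      (ne_of_eq_of_ne (hαY q) one_ne_zero)) v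
  rwa [hself, zero_div, zero_mul] at hker

theorem IsReebForm.surjective_mfderiv (hα : IsReebForm Y α) (h : FlowPreserves Y (kerField α))
    (hΦ : IsLocalFlow Y U ε Φ) (ht : t ∈ Set.Ioo (-ε) ε) (hq : q ∈ U) :
    Function.Surjective (mfderiv (𝓡 3) (𝓡 3) (Φ t) q) := fun w => by
  set D := mfderiv (𝓡 3) (𝓡 3) (Φ t) q
  have hmem : w - α (Φ t q) w • D (Y q) ∈ kerField α (Φ t q) := by
    rw [mem_kerField, map_sub, map_smul, hα.pullback_eq hΦ ht hq, hα.apply_field, smul_eq_mul,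
      mul_one, sub_self]
  rw [← h.2 U ε Φ hΦ t ht q hq] at hmem
  obtain ⟨v, -, hv⟩ := hmem
  exact ⟨v + α (Φ t q) w • Y q, by rw [map_add, map_smul]; exact eq_sub_iff_add_eq.1 hv⟩

theorem IsReebForm.flowPreserves (hα : IsReebForm Y α) (h : FlowPreserves Y (kerField α))
    (hβ : IsReebForm Y β) : FlowPreserves Y (kerField β) := by
  refine ⟨h.1, fun U ε Φ hΦ t ht q hq => le_antisymm ?_ fun w hw => ?_⟩
  · rintro _ ⟨v, hv, rfl⟩
    exact (hβ.pullback_eq hΦ ht hq v).trans hv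
  · obtain ⟨v, rfl⟩ := hα.surjective_mfderiv h hΦ ht hq w
    exact ⟨v, (hβ.pullback_eq hΦ ht hq v).symm.trans hw, rfl⟩

theorem exists_normalized_form {ξ : Distribution M} (hξ : IsContactStructure ξ)
    (hY : SmoothVFieldOn Y Set.univ) (hYξ : ∀ q, Y q ∉ ξ q) :
    ∃ α : OneForm M, SmoothOneFormOn α Set.univ ∧ kerField α = ξ ∧ ∀ q, α q (Y q) = 1 := by
  choose U hU β hβ using hξ
  have hne (m) (q) (hq : q ∈ U m) : β m q (Y q) ≠ 0 := fun h =>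
    hYξ q ((hβ m).ker_eq q hq ▸ mem_kerField.2 h)
  let α : OneForm M := fun q => (β q q (Y q))⁻¹ • β q q
  have hαY (q) : α q (Y q) = 1 := inv_mul_cancel₀ (hne q q (hU q))
  have hker : kerField α = ξ := by
    funext q
    rw [← (hβ q).ker_eq q (hU q)]
    exact LinearMap.ker_smul _ _ (inv_ne_zero (hne q q (hU q)))
  refine ⟨α, fun m _ => ContMDiffAt.contMDiffWithinAt ?_, hker, hαY⟩
  have hUm : U m ∈ 𝓝 m := (hβ m).isOpen.mem_nhds (hU m)
  have hinv := ((hβ m).smooth.contMDiffAt_apply (hY.mono (Set.subset_univ _)) hUm).inv₀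
    (hne m m (hU m))
  refine (hinv.smul_section ((hβ m).smooth.contMDiffAt hUm)).congr_of_eventuallyEq ?_
  filter_upwards [hUm] with q hq
  have hβα : β m q = β m q (Y q) • α q :=
    eq_apply_smul_of_kerField_eq (((hβ m).ker_eq q hq).trans (congrFun hker q).symm) (hαY q)
  have hαβ : α q = (β m q (Y q))⁻¹ • β m q := (eq_inv_smul_iff₀ (hne m q hq)).2 hβα.symm
  rw [hαβ]
  rfl

theorem IsReebField.exists_isReebForm {ξ : Distribution M} (hY : IsReebField ξ Y)
    (hξ : IsContactStructure ξ) : ∃ α : OneForm M, IsReebForm Y α ∧ kerField α = ξ := by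
  obtain ⟨α, hα, rfl, hαY⟩ := exists_normalized_form hξ hY.smooth hY.transverse
  exact ⟨α, hY.preserves.isReebForm hα hαY, rfl⟩

theorem IsContactFormOn.wedgeD_self_eq (hβ : IsContactFormOn (kerField α) β U)
    (hα : SmoothOneFormOn α Set.univ) (hY : SmoothVFieldOn Y Set.univ)
    (hαY : ∀ q, α q (Y q) = 1) (hq : q ∈ U) (u v w : TangentSpace (𝓡 3) q) :
    wedgeD β β q u v w = β q (Y q) ^ 2 * wedgeD α α q u v w := by
  have hU : U ∈ 𝓝 q := hβ.isOpen.mem_nhds hq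
  have hβα : ∀ᶠ x in 𝓝 q, β x = β x (Y x) • α x := by
    filter_upwards [hU] with x hx using eq_apply_smul_of_kerField_eq (hβ.ker_eq x hx) (hαY x)
  have hsmooth := hβ.smooth.contMDiffAt_apply (hY.mono (Set.subset_univ U)) hU
  rw [wedgeD_self_congr hβα, wedgeD_smul_self (hsmooth.mdifferentiableAt (by simp)) hα]

theorem IsReebForm.isContactFormOn (hα : IsReebForm Y α) (hY : SmoothVFieldOn Y Set.univ)
    (hξ : IsContactStructure (kerField α)) : IsContactFormOn (kerField α) α Set.univ := by
  refine ⟨isOpen_univ, hα.smooth, fun _ _ => rfl, fun q _ => ?_⟩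
  obtain ⟨U, hq, β, hβ⟩ := hξ q
  obtain ⟨u, v, w, h⟩ := hβ.nondegenerate q hq
  rw [hβ.wedgeD_self_eq hα.smooth hY hα.apply_field hq] at h
  exact ⟨u, v, w, right_ne_zero_of_mul h⟩

theorem IsReebForm.commonlyOriented (hα : IsReebForm Y α) (hα' : IsReebForm Y α')
    (hY : SmoothVFieldOn Y Set.univ) (hvol : ∀ q, wedgeD α' α' q = wedgeD α α q) :
    CommonlyOriented (kerField α) (kerField α') := by
  intro U β β' hβ hβ' q hq
  have hβY := hβ.apply_field_ne_zero hα.apply_field hq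
  have hβY' := hβ'.apply_field_ne_zero hα'.apply_field hq
  refine ⟨β q (Y q) ^ 2 / β' q (Y q) ^ 2, by positivity, fun u v w => ?_⟩
  rw [hβ.wedgeD_self_eq hα.smooth hY hα.apply_field hq,
    hβ'.wedgeD_self_eq hα'.smooth hY hα'.apply_field hq, hvol]
  field_simp

end ReebForms

section LinearAlgebra

variable {K V : Type*} [Field K] [AddCommGroup V] [Module K V]

theorem linearIndependent_of_isAlt {B : V →ₗ[K] V →ₗ[K] K} (hB : B.IsAlt) {y v w : V}
    (hy : y ≠ 0) (hBy : B y = 0) (hvw : B v w ≠ 0) : LinearIndependent K ![y, v, w] := by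
  rw [Fintype.linearIndependent_iff]
  intro c hc
  simp only [Fin.sum_univ_three, Matrix.cons_val] at hc
  have hBc (x : V) : c 1 * B v x + c 2 * B w x = 0 := by
    have h := congrArg (fun u => B u x) hc
    simpa only [map_add, map_smul, hBy, smul_zero, zero_add, LinearMap.add_apply,
      LinearMap.smul_apply, smul_eq_mul, map_zero, LinearMap.zero_apply] using h
  have h1 : c 1 = 0 := by simpa [hB.self_eq_zero, hvw] using hBc w
  have hwv : B w v ≠ 0 := fun h => hvw (by rw [← hB.neg, h, neg_zero])
  have h2 : c 2 = 0 := by simpa [h1, hwv] using hBc v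
  have h0 : c 0 = 0 := by simpa [h1, h2, hy] using hc
  intro i
  fin_cases i <;> assumption

theorem isAlt_apply_eq_zero_of_mem_ker (hV : Module.finrank K V = 3) {B : V →ₗ[K] V →ₗ[K] K}
    (hB : B.IsAlt) {y : V} (hy : y ≠ 0) (hBy : B y = 0) {g : V →ₗ[K] K} (hg : g ≠ 0)
    (hgy : g y = 0) {v w : V} (hv : g v = 0) (hw : g w = 0) : B v w = 0 := by
  by_contra hvw
  have hspan := (linearIndependent_of_isAlt hB hy hBy hvw).span_eq_top_of_card_eq_finrank
    (by rw [hV, Fintype.card_fin])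
  refine hg (LinearMap.ext_on_range hspan fun i => ?_)
  fin_cases i <;> simp [hgy, hv, hw]

end LinearAlgebra

section LeafwiseClosed

variable {M : Type*} [TopologicalSpace M] [ChartedSpace R3 M] {α β γ : OneForm M} {Y : VField M}
  {q m : M}

/-- `α` restricts to a closed form on the leaves of the foliation `ker γ`. -/
def IsLeafwiseClosed (α γ : OneForm M) : Prop :=
  ∀ (q : M) (v w : TangentSpace (𝓡 3) q), γ q v = 0 → γ q w = 0 → extD α q v w = 0

variable [IsManifold (𝓡 3) ∞ M]

theorem IsReebForm.isLeafwiseClosed (hα : IsReebForm Y α) (hγY : ∀ q, γ q (Y q) = 0)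
    (hγ0 : ∀ q, γ q ≠ 0) : IsLeafwiseClosed α γ := by
  intro q v w hv hw
  have hY : Y q ≠ 0 := fun h => one_ne_zero (by rw [← hα.apply_field q, h, map_zero])
  exact isAlt_apply_eq_zero_of_mem_ker (V := R3) (finrank_euclideanSpace_fin)
    (B := (dForm (inChart α q) (extChartAt (𝓡 3) q q)).toLinearMap₁₂)
    (fun v => dForm_self _ _ v) hY (LinearMap.ext fun v => hα.extD_field q v)
    (g := (γ q).toLinearMap) (fun h => hγ0 q (ContinuousLinearMap.coe_injective h)) (hγY q) hv hw

theorem IsLeafwiseClosed.dForm_inChart_eq_zero (h : IsLeafwiseClosed α γ)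
    (hα : SmoothOneFormOn α Set.univ) {z : R3} (hz : z ∈ (extChartAt (𝓡 3) m).target) {v w : R3}
    (hv : inChart γ m z v = 0) (hw : inChart γ m z w = 0) : dForm (inChart α m) z v w = 0 := by
  rw [← (extChartAt (𝓡 3) m).image_source_eq_target] at hz
  obtain ⟨q, hq, rfl⟩ := hz
  obtain ⟨v, rfl⟩ := dChart_surjective hq v
  obtain ⟨w, rfl⟩ := dChart_surjective hq w
  rw [inChart_dChart γ hq] at hv hw
  rw [dForm_inChart_dChart hα hq, h q v w hv hw]

theorem IsClosedForm.dForm_inChart_eq_zero (hγ : IsClosedForm γ) {z : R3}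
    (hz : z ∈ (extChartAt (𝓡 3) m).target) : dForm (inChart γ m) z = 0 := by
  have h : IsLeafwiseClosed γ 0 := fun q v w _ _ => hγ.closed q v w
  ext v w
  exact h.dForm_inChart_eq_zero hγ.smooth hz rfl rfl

theorem IsLeafwiseClosed.exists_hasClebschPotentials_inChart (h : IsLeafwiseClosed α γ)
    (hα : SmoothOneFormOn α Set.univ) (hγ : IsClosedForm γ) (hγm : γ m ≠ 0) :
    ∃ t p f : R3 → ℝ, (∀ᶠ z in 𝓝 (extChartAt (𝓡 3) m m), fderiv ℝ f z = inChart γ m z) ∧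
      HasClebschPotentials (inChart α m) t p f (extChartAt (𝓡 3) m m) := by
  have htarget := extChartAt_target_mem_nhds (I := 𝓡 3) m
  have hsmooth {β : OneForm M} (hβ : SmoothOneFormOn β Set.univ) :
      ∀ᶠ z in 𝓝 (extChartAt (𝓡 3) m m), ContDiffAt ℝ ∞ (inChart β m) z :=
    eventually_of_mem htarget fun z hz => contDiffAt_inChart hβ hz univ_mem
  obtain ⟨f, hf⟩ := exists_local_primitive (hsmooth hγ.smooth)
    (eventually_of_mem htarget fun z hz => hγ.dForm_inChart_eq_zero hz)
  have hf₀ : fderiv ℝ f (extChartAt (𝓡 3) m m) ≠ 0 := by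
    rw [hf.self_of_nhds.2]
    exact fun h0 => hγm (ContinuousLinearMap.ext fun v =>
      (inChart_self γ m v).symm.trans (DFunLike.congr_fun h0 v))
  obtain ⟨t, p, htp⟩ := exists_hasClebschPotentials (hsmooth hα) (hf.mono fun z hz => hz.1) (by
    filter_upwards [htarget, hf] with z hz hfz v w hv hw
    rw [hfz.2] at hv hw
    exact h.dForm_inChart_eq_zero hα hz hv hw) hf₀
  exact ⟨t, p, f, hf.mono fun z hz => hz.2, htp⟩

theorem extD_apply_of_hasClebschPotentials {t p f : R3 → ℝ}
    (hf : fderiv ℝ f (extChartAt (𝓡 3) m m) = inChart γ m (extChartAt (𝓡 3) m m))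
    (h : HasClebschPotentials (inChart α m) t p f (extChartAt (𝓡 3) m m))
    (v w : TangentSpace (𝓡 3) m) :
    extD α m v w = fderiv ℝ p (extChartAt (𝓡 3) m m) v * γ m w -
      fderiv ℝ p (extChartAt (𝓡 3) m m) w * γ m v := by
  have hd := h.dForm_apply v w
  rw [hf, inChart_self, inChart_self] at hd
  exact hd

end LeafwiseClosed

section ContactPairs

variable {M : Type*} [TopologicalSpace M] [ChartedSpace R3 M] {α β γ : OneForm M} {Y : VField M}
  {q : M}

theorem wedgeD_eq_tripleWedge {η : TangentSpace (𝓡 3) q →L[ℝ] ℝ}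
    (hη : ∀ v w, extD α q v w = η v * γ q w - η w * γ q v) :
    wedgeD β α q = tripleWedge (β q) η (γ q) := by
  funext u v w
  rw [wedgeD, tripleWedge_apply, hη, hη, hη]

theorem wedgeD_add_left (u v w : TangentSpace (𝓡 3) q) :
    wedgeD (fun q => β q + γ q) α q u v w = wedgeD β α q u v w + wedgeD γ α q u v w := by
  simp only [wedgeD, add_apply]
  ring

theorem wedge_add_self (v w : TangentSpace (𝓡 3) q) :
    wedge α (fun q => α q + γ q) q v w = wedge α γ q v w := by
  simp only [wedge, add_apply]
  ring

theorem transverse_kerField_add (hαY : ∀ q, α q (Y q) = 1) (hγY : ∀ q, γ q (Y q) = 0)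
    (hγ0 : ∀ q, γ q ≠ 0) : Transverse (kerField α) (kerField fun q => α q + γ q) := by
  intro q
  obtain ⟨v, hv⟩ : ∃ v, γ q v ≠ 0 := by
    by_contra! h
    exact hγ0 q (ContinuousLinearMap.ext h)
  have hα : α q (v - α q v • Y q) = 0 := by rw [map_sub, map_smul, hαY]; simp
  have hγ : γ q (v - α q v • Y q) = γ q v := by rw [map_sub, map_smul, hγY]; simp
  set x := v - α q v • Y q
  refine eq_top_iff.2 fun u _ => Submodule.mem_sup.2
    ⟨((α q u + γ q u) / γ q v) • x, ?_, u - ((α q u + γ q u) / γ q v) • x, ?_, add_sub_cancel _ _⟩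
  · rw [mem_kerField, map_smul, hα, smul_zero]
  · rw [mem_kerField, map_sub, map_smul, add_apply, add_apply, hα, hγ, zero_add, smul_eq_mul,
      div_mul_cancel₀ _ hv, sub_self]

variable [IsManifold (𝓡 3) ∞ M]

theorem wedgeD_add_isClosedForm (hα : SmoothOneFormOn α Set.univ) (hγ : IsClosedForm γ) :
    wedgeD β (fun q => α q + γ q) q = wedgeD β α q := by
  funext u v w
  simp only [wedgeD, extD_add hα hγ.smooth, hγ.closed, add_zero]

theorem IsLeafwiseClosed.exists_extD_eq (h : IsLeafwiseClosed α γ)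
    (hα : SmoothOneFormOn α Set.univ) (hγ : IsClosedForm γ) (hγq : γ q ≠ 0) :
    ∃ η : TangentSpace (𝓡 3) q →L[ℝ] ℝ, ∀ v w, extD α q v w = η v * γ q w - η w * γ q v := by
  obtain ⟨t, p, f, hf, htp⟩ := h.exists_hasClebschPotentials_inChart hα hγ hγq
  exact ⟨fderiv ℝ p (extChartAt (𝓡 3) q q), extD_apply_of_hasClebschPotentials hf.self_of_nhds htp⟩

theorem IsLeafwiseClosed.wedgeD_add_self (h : IsLeafwiseClosed α γ)
    (hα : SmoothOneFormOn α Set.univ) (hγ : IsClosedForm γ) (hγq : γ q ≠ 0) :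
    wedgeD (fun q => α q + γ q) α q = wedgeD α α q := by
  obtain ⟨η, hη⟩ := h.exists_extD_eq hα hγ hγq
  funext u v w
  have hγα : wedgeD γ α q u v w = 0 := by
    rw [wedgeD_eq_tripleWedge hη, tripleWedge_apply]
    ring
  rw [wedgeD_add_left, hγα, add_zero]

theorem IsLeafwiseClosed.wedgeD_add_self_add_self (h : IsLeafwiseClosed α γ)
    (hα : SmoothOneFormOn α Set.univ) (hγ : IsClosedForm γ) (hγq : γ q ≠ 0) :
    wedgeD (fun q => α q + γ q) (fun q => α q + γ q) q = wedgeD α α q := by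
  rw [wedgeD_add_isClosedForm hα hγ, h.wedgeD_add_self hα hγ hγq]

-- Where `dα = η ∧ γ`, contracting `α ∧ η ∧ γ` with `x` such that `α x = γ x = 0`, `η x = -1`
-- leaves `α ∧ γ`.
theorem IsLeafwiseClosed.exists_axis_vector (h : IsLeafwiseClosed α γ)
    (hα : SmoothOneFormOn α Set.univ) (hγ : IsClosedForm γ) (hγq : γ q ≠ 0)
    (hvol : ∃ u v w, wedgeD α α q u v w ≠ 0) :
    ∃ x, α q x = 0 ∧ γ q x = 0 ∧ ∀ v w, wedgeD α α q x v w = wedge α γ q v w := by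
  obtain ⟨η, hη⟩ := h.exists_extD_eq hα hγ hγq
  obtain ⟨u, v, w, huvw⟩ := hvol
  rw [wedgeD_eq_tripleWedge hη] at huvw
  obtain ⟨x, hαx, hηx, hγx⟩ := exists_apply_eq_of_tripleWedge_ne_zero (α q).toLinearMap
    η.toLinearMap (γ q).toLinearMap huvw 0 (-1) 0
  simp only [ContinuousLinearMap.coe_coe] at hαx hηx hγx
  refine ⟨x, hαx, hγx, fun v w => ?_⟩
  rw [wedgeD_eq_tripleWedge hη, tripleWedge_apply, hαx, hηx, hγx, wedge]
  ring

theorem IsContactFormOn.isContactStructure {ξ : Distribution M}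
    (hα : IsContactFormOn ξ α Set.univ) : IsContactStructure ξ :=
  fun m => ⟨Set.univ, Set.mem_univ m, α, hα⟩

theorem IsContactFormOn.add_isClosedForm (hα : IsContactFormOn (kerField α) α Set.univ)
    (h : IsLeafwiseClosed α γ) (hγ : IsClosedForm γ) (hγ0 : ∀ q, γ q ≠ 0) :
    IsContactFormOn (kerField fun q => α q + γ q) (fun q => α q + γ q) Set.univ where
  isOpen := isOpen_univ
  smooth := hα.smooth.add hγ.smooth
  ker_eq _ _ := rfl
  nondegenerate q hq := by
    rw [h.wedgeD_add_self_add_self hα.smooth hγ (hγ0 q)]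
    exact hα.nondegenerate q hq

theorem exists_isGeneratingInvariant_two (hα : IsContactFormOn (kerField α) α Set.univ)
    (h : IsLeafwiseClosed α γ) (hγ : IsClosedForm γ) (hγ0 : ∀ q, γ q ≠ 0) :
    ∃ X, IsGeneratingInvariant (kerField α) (kerField fun q => α q + γ q) X fun _ => 2 := by
  choose X hαX hγX hX using fun q =>
    h.exists_axis_vector hα.smooth hγ (hγ0 q) (hα.nondegenerate q (Set.mem_univ q))
  refine ⟨X, fun m => ⟨Set.univ, α, _, Set.mem_univ m, hα, hα.add_isClosedForm h hγ hγ0,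
    fun q _ => ⟨⟨hαX q, ?_⟩, fun u v w => ?_, fun v w => ?_, fun u v w => ?_⟩⟩⟩
  · rw [SetLike.mem_coe, mem_kerField, add_apply, hαX, hγX, add_zero]
  · rw [h.wedgeD_add_self_add_self hα.smooth hγ (hγ0 q)]
  · rw [wedge_add_self, hX]
  · rw [wedgeD_add_isClosedForm hα.smooth hγ, h.wedgeD_add_self hα.smooth hγ (hγ0 q), two_mul]

end ContactPairs

section TypeI2

variable {M : Type*} [TopologicalSpace M] [ChartedSpace R3 M] {α γ : OneForm M} {m q : M}

theorem trans_mem_maximalAtlas {φ : OpenPartialHomeomorph M R3}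
    (hφ : φ ∈ IsManifold.maximalAtlas (𝓡 3) ∞ M) {e : OpenPartialHomeomorph R3 R3}
    (he : ContDiffOn ℝ ∞ e e.source) (he' : ContDiffOn ℝ ∞ e.symm e.target) :
    φ ≫ₕ e ∈ IsManifold.maximalAtlas (𝓡 3) ∞ M := by
  have heG : e ∈ contDiffGroupoid ∞ (𝓡 3) := by
    rw [contDiffGroupoid, mem_groupoid_of_pregroupoid]
    simpa [contDiffPregroupoid] using And.intro he he'
  intro e₁ he₁
  obtain ⟨h₁, h₂⟩ := mem_maximalAtlas_iff.1 hφ e₁ he₁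
  constructor
  · rw [OpenPartialHomeomorph.trans_symm_eq_symm_trans_symm, OpenPartialHomeomorph.trans_assoc]
    exact StructureGroupoid.trans _ (StructureGroupoid.symm _ heG) h₁
  · rw [← OpenPartialHomeomorph.trans_assoc]
    exact StructureGroupoid.trans _ h₂ heG

variable [IsManifold (𝓡 3) ∞ M]

theorem mfderiv_coordinate_comp_extChartAt {e : R3 → R3} (hq : q ∈ (extChartAt (𝓡 3) m).source)
    (he : DifferentiableAt ℝ e (extChartAt (𝓡 3) m q)) (i : Fin 3) (v : TangentSpace (𝓡 3) q) :
    mfderiv (𝓡 3) 𝓘(ℝ, ℝ) (fun q => e (extChartAt (𝓡 3) m q) i) q v =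
      fderiv ℝ e (extChartAt (𝓡 3) m q) (dChart m q v) i := by
  have hei : HasFDerivAt (fun z => e z i)
      ((EuclideanSpace.proj i : R3 →L[ℝ] ℝ).comp (fderiv ℝ e (extChartAt (𝓡 3) m q)))
      (extChartAt (𝓡 3) m q) :=
    (EuclideanSpace.proj i : R3 →L[ℝ] ℝ).hasFDerivAt.comp _ he.hasFDerivAt
  have h := hei.hasMFDerivAt.comp q (hasMFDerivAt_extChartAt_dChart hq)
  exact DFunLike.congr_fun h.mfderiv v

theorem inChart_self_coe (α : OneForm M) (m : M) :
    (inChart α m (extChartAt (𝓡 3) m m) : TangentSpace (𝓡 3) m → ℝ) = α m :=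
  funext (inChart_self α m)

theorem isTypeI2At_of_hasClebschPotentials {t p f : R3 → ℝ}
    (hf : ∀ᶠ z in 𝓝 (extChartAt (𝓡 3) m m), fderiv ℝ f z = inChart γ m z)
    (h : HasClebschPotentials (inChart α m) t p f (extChartAt (𝓡 3) m m))
    (hvol : ∃ u v w, wedgeD α α m u v w ≠ 0) :
    IsTypeI2At (kerField α) (kerField fun q => α q + γ q) 2 m := by
  rw [wedgeD_eq_tripleWedge (extD_apply_of_hasClebschPotentials hf.self_of_nhds h),
    ← inChart_self_coe α, ← inChart_self_coe γ, ← hf.self_of_nhds] at hvol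
  obtain ⟨e, hm, hem, he, he', hcoord⟩ := h.exists_typeI2_coordinates hvol
  obtain ⟨s, hs, hs_open, hms⟩ := eventually_nhds_iff.1
    ((continuousAt_extChartAt (I := 𝓡 3) m).eventually (hcoord.and hf))
  refine ⟨(chartAt R3 m ≫ₕ e).restr s, restr_mem_maximalAtlas _
    (trans_mem_maximalAtlas (IsManifold.chart_mem_maximalAtlas m) he he') hs_open,
    ⟨⟨mem_chart_source R3 m, hm⟩, by rwa [hs_open.interior_eq]⟩, hem, ?_⟩
  rintro q ⟨⟨hqm, hqe⟩, hqs⟩ v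
  have hq : q ∈ (extChartAt (𝓡 3) m).source := by rwa [extChartAt_source]
  have hd := mfderiv_coordinate_comp_extChartAt hq
    ((he.contDiffAt (e.open_source.mem_nhds hqe)).differentiableAt (by simp))
  obtain ⟨hcoord_q, hf_q⟩ := hs q (interior_subset hqs)
  obtain ⟨hξ, hξ'⟩ := hcoord_q (dChart m q v)
  rw [inChart_dChart α hq] at hξ hξ'
  rw [hf_q, inChart_dChart γ hq] at hξ'
  rw [← hd, ← hd] at hξ hξ'
  exact ⟨hξ, hξ'⟩

theorem IsLeafwiseClosed.isTypeI2At (h : IsLeafwiseClosed α γ)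
    (hα : IsContactFormOn (kerField α) α Set.univ) (hγ : IsClosedForm γ) (hγm : γ m ≠ 0) :
    IsTypeI2At (kerField α) (kerField fun q => α q + γ q) 2 m := by
  obtain ⟨t, p, f, hf, htp⟩ := h.exists_hasClebschPotentials_inChart hα.smooth hγ hγm
  exact isTypeI2At_of_hasClebschPotentials hf htp (hα.nondegenerate m (Set.mem_univ m))

end TypeI2

section Coplanar

variable {M : Type*} [TopologicalSpace M] [ChartedSpace R3 M] {γ : OneForm M} {L : Distribution M}
  {q : M} {y : TangentSpace (𝓡 3) q}

theorem apply_eq_zero_of_sup_span_eq_kerField (h : L q ⊔ Submodule.span ℝ {y} = kerField γ q) :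
    γ q y = 0 :=
  mem_kerField.1 (h ▸ Submodule.mem_sup_right (Submodule.mem_span_singleton_self y))

variable [IsManifold (𝓡 3) ∞ M]

theorem IsLineField.ne_zero_of_sup_span_eq_kerField (hL : IsLineField L)
    (h : L q ⊔ Submodule.span ℝ {y} = kerField γ q) : γ q ≠ 0 := by
  rintro hγ
  obtain ⟨U, -, hq, Z, -, hZ⟩ := hL q
  have htop : kerField γ q = ⊤ := LinearMap.ker_eq_top.2 (by rw [hγ]; rfl)
  rw [(hZ q hq).2, htop, ← Submodule.span_union, Set.singleton_union] at h
  let z₁ : R3 := Z q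
  let z₂ : R3 := y
  have hspan : Submodule.span ℝ (({z₁, z₂} : Finset R3) : Set R3) = ⊤ := by
    rw [Finset.coe_pair]
    exact h
  have hrank := (finrank_span_finset_le_card (R := ℝ) ({z₁, z₂} : Finset R3)).trans
    Finset.card_le_two
  rw [Set.finrank, hspan, finrank_top, finrank_euclideanSpace_fin] at hrank
  omega

end Coplanar

end ContactPair

end

theorem mainTheorem3_general {M : Type*} [TopologicalSpace M]
    [ChartedSpace ContactPair.R3 M] [IsManifold (𝓡 3) ∞ M]
    (ξ : ContactPair.Distribution M) (hξ : ContactPair.IsContactStructure ξ)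
    (Y : ContactPair.VField M) (hY : ContactPair.IsReebField ξ Y)
    (γ : ContactPair.OneForm M) (hγ : ContactPair.IsClosedForm γ)
    (hγY : ∀ q, γ q (Y q) = 0) (hγ0 : ∀ q, γ q ≠ 0) :
    ∃ α : ContactPair.OneForm M,
      (ContactPair.IsContactFormOn ξ α Set.univ ∧ (∀ q, α q (Y q) = 1) ∧
        (∀ q v, ContactPair.extD α q (Y q) v = 0)) ∧
      ∃ ξ' : ContactPair.Distribution M,
        ξ' = ContactPair.kerField (fun q => α q + γ q) ∧
        ContactPair.IsContactStructure ξ' ∧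
        ContactPair.Transverse ξ ξ' ∧
        ContactPair.CommonlyOriented ξ ξ' ∧
        ContactPair.FlowPreserves Y ξ' ∧
        (∃ X : ContactPair.VField M,
          ContactPair.IsGeneratingInvariant ξ ξ' X (fun _ => 2)) ∧
        ∀ m, ContactPair.IsTypeI2At ξ ξ' 2 m := by
  open ContactPair in
  obtain ⟨α, hα, rfl⟩ := hY.exists_isReebForm hξ
  have hαξ := hα.isContactFormOn hY.smooth hξ
  have hαγ := hα.isLeafwiseClosed hγY hγ0
  have hα' := hα.add_isClosedForm hγ hγY
  exact ⟨α, ⟨hαξ, hα.apply_field, hα.extD_field⟩, _, rfl,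
    (hαξ.add_isClosedForm hαγ hγ hγ0).isContactStructure,
    transverse_kerField_add hα.apply_field hγY hγ0,
    hα.commonlyOriented hα' hY.smooth fun q => hαγ.wedgeD_add_self_add_self hα.smooth hγ (hγ0 q),
    hα.flowPreserves hY.preserves hα',
    exists_isGeneratingInvariant_two hαξ hαγ hγ hγ0,
    fun m => hαγ.isTypeI2At hαξ hγ (hγ0 m)⟩

theorem mainTheorem3 {M : Type*} [TopologicalSpace M] [T2Space M]
    [ChartedSpace ContactPair.R3 M] [IsManifold (𝓡 3) ∞ M]
    (ξ : ContactPair.Distribution M) (hξ : ContactPair.IsContactStructure ξ)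
    (Y : ContactPair.VField M) (L : ContactPair.Distribution M)
    (hY : ContactPair.IsContactIntegrable ξ Y L)
    (γ : ContactPair.OneForm M) (hγ : ContactPair.IsClosedForm γ)
    (hker : ∀ q, L q ⊔ Submodule.span ℝ {Y q} = ContactPair.kerField γ q) :
    ∃ α : ContactPair.OneForm M,
      (ContactPair.IsContactFormOn ξ α Set.univ ∧ (∀ q, α q (Y q) = 1) ∧
        (∀ q v, ContactPair.extD α q (Y q) v = 0)) ∧
      ∃ ξ' : ContactPair.Distribution M,
        ξ' = ContactPair.kerField (fun q => α q + γ q) ∧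
        ContactPair.IsContactStructure ξ' ∧
        ContactPair.Transverse ξ ξ' ∧
        ContactPair.CommonlyOriented ξ ξ' ∧
        ContactPair.FlowPreserves Y ξ' ∧
        (∃ X : ContactPair.VField M,
          ContactPair.IsGeneratingInvariant ξ ξ' X (fun _ => 2)) ∧
        ∀ m, ContactPair.IsTypeI2At ξ ξ' 2 m :=
  mainTheorem3_general ξ hξ Y hY.reeb γ hγ
    (fun q => ContactPair.apply_eq_zero_of_sup_span_eq_kerField (hker q))
    (fun q => hY.lineField.ne_zero_of_sup_span_eq_kerField (hker q))
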